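/- **Setting.** States are density matrices on $\mathbb C^d\otimes\mathbb C^d$, $V$ is the swap unitary $V(\varphi\otimes\psi)=\psi\otimes\varphi$, and LOCC operations are finite-round protocols of local operations (local ancillas allowed) and classical communication. $\overline{\mathrm{LOCC}}$ denotes the closure of the set of LOCC operations on $\mathbb C^d\otimes\mathbb C^d$. A separable operation is a trace preserving map $X\mapsto\sum_i (A_i\otimes B_i)X(A_i\otimes B_i)^\dagger$ (finite sum, $A_i,B_i$ acting on $\mathbb C^d$). A state $\sigma$ is *swappable* by a class of operations if some $\Lambda$ in the class satisfies $\Lambda(\sigma)=V\sigma V$. Let $G$ be the convex roof $G(\rho)=\inf\sum_i G(\psi_i)$ over finite decompositions $\rho=\sum_i|\psi_i\rangle\langle\psi_i|$, where $G(\psi)=d\,(\det\rho_A)^{1/d}$ with $\rho_A=\mathrm{Tr}_B|\psi\rangle\langle\psi|$. Let $D$ be a real-valued function on pairs of states of $\mathbb C^d\otimes\mathbb C^d$ that is jointly continuous, satisfies $D(\Lambda(\rho),\Lambda(\tau))\le D(\rho,\tau)$ for all LOCC operations $\Lambda$, and satisfies $D(\rho,\tau)=0$ if and only if $\rho=\tau$.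 (In particular, $D$ may be any such function that is contractive under all quantum operations.) Put $E^D(\rho)=\inf_{\tau\ \mathrm{separable}}D(\rho,\tau)$. For a state $\sigma$ define $$E_\sigma(\rho)=E^D(\sigma)-\inf_{\Lambda\in\mathrm{LOCC}}D(\sigma,\Lambda(\rho)).$$ **Theorem.** For every $d$, every such $D$ and every state $\sigma$: 1. $E_\sigma\ge 0$, and $E_\sigma(\rho)=0$ for every separable state $\rho$; 2. $E_\sigma(\Lambda(\rho))\le E_\sigma(\rho)$ for every LOCC operation $\Lambda$ and every state $\rho$; 3. $E_\sigma(\sigma)=E^D(\sigma)$; 4. $E_\sigma(V\sigma V)<E_\sigma(\sigma)$ if and only if $\sigma$ is not swappable by $\overline{\mathrm{LOCC}}$. In particular $E_\sigma(V\sigma V)<E_\sigma(\sigma)$ holds whenever $\sigma$ is not swappable by separable operations, and also whenever $G(\sigma)>0$ and $\sigma$ is not swappable by LOCC operations. Such $\sigma$ exist: if $d=2$, $0<p<1$, $a,b>0$, $a^2+b^2=1$, $a\ne b$ and $\varphi=a|00\rangle+b|11\rangle$, then the state $$\sigma=p\,|01\rangle\langle 01|+(1-p)\,|\varphi\rangle\langle\varphi|$$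 has $G(\sigma)>0$, is swappable neither by LOCC operations nor by separable operations, and satisfies $E_\sigma(V\sigma V)<E_\sigma(\sigma)$ for every $D$ as above. Hence $E_\sigma$ is a non-symmetric entanglement measure. -/

import Mathlib

open scoped Kronecker ComplexOrder

namespace AsymEnt

/-- Operators on `ℂ^a ⊗ ℂ^b`, as matrices in the product basis. -/
abbrev BiMat (a b : ℕ) : Type := Matrix (Fin a × Fin b) (Fin a × Fin b) ℂ

/-- Density matrices: positive semidefinite of unit trace. -/
def IsDensity {ι : Type} [Fintype ι] (ρ : Matrix ι ι ℂ) : Prop :=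
  ρ.PosSemidef ∧ ρ.trace = 1

/-- States of a bipartite system `ℂ^d ⊗ ℂ^d` (with the topology of matrices). -/
abbrev State (d : ℕ) : Type := {ρ : BiMat d d // IsDensity ρ}

/-- Finite-round LOCC operations from operators on `ℂ^a ⊗ ℂ^b` to operators on `ℂ^m ⊗ ℂ^n`.
A protocol is either finished, or one party performs a finite local measurement with Kraus operators
`A i` (with arbitrary, possibly different, output dimension, so that local ancillas may be added
and discarded), announces the outcome `i`, and the parties continue with a protocol `Λ i` that may
depend on `i`. -/
inductive IsLOCC {m n : ℕ} : {a b : ℕ} → (BiMat a b → BiMat m n) → Prop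
  | finish : IsLOCC (fun X : BiMat m n => X)
  | alice {a b a' k : ℕ} (A : Fin k → Matrix (Fin a') (Fin a) ℂ)
      (hA : ∑ i, (A i).conjTranspose * A i = 1)
      (Λ : Fin k → BiMat a' b → BiMat m n) (hΛ : ∀ i, IsLOCC (Λ i)) :
      IsLOCC (fun X : BiMat a b => ∑ i, Λ i
        ((A i ⊗ₖ (1 : Matrix (Fin b) (Fin b) ℂ)) * X *
          (A i ⊗ₖ (1 : Matrix (Fin b) (Fin b) ℂ)).conjTranspose))
  | bob {a b b' k : ℕ} (B : Fin k → Matrix (Fin b') (Fin b) ℂ)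
      (hB : ∑ i, (B i).conjTranspose * B i = 1)
      (Λ : Fin k → BiMat a b' → BiMat m n) (hΛ : ∀ i, IsLOCC (Λ i)) :
      IsLOCC (fun X : BiMat a b => ∑ i, Λ i
        (((1 : Matrix (Fin a) (Fin a) ℂ) ⊗ₖ B i) * X *
          ((1 : Matrix (Fin a) (Fin a) ℂ) ⊗ₖ B i).conjTranspose))

/-- The set of LOCC operations on `ℂ^d ⊗ ℂ^d`. Its `closure` is taken in the topology of pointwise
convergence, which on linear maps of matrices is the usual topology. -/
def LOCC (d : ℕ) : Set (BiMat d d → BiMat d d) := {Λ | IsLOCC Λ}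

/-- The set of trace preserving separable operations on `ℂ^d ⊗ ℂ^d`. -/
def SEP (d : ℕ) : Set (BiMat d d → BiMat d d) :=
  {Λ | ∃ (k : ℕ) (A B : Fin k → Matrix (Fin d) (Fin d) ℂ),
    ∑ i, (A i ⊗ₖ B i).conjTranspose * (A i ⊗ₖ B i) = 1 ∧
    ∀ X, Λ X = ∑ i, (A i ⊗ₖ B i) * X * (A i ⊗ₖ B i).conjTranspose}

theorem trace_sum_kraus {ι κ : Type} [Fintype ι] [Fintype κ] [DecidableEq ι] {k : ℕ}
    (K : Fin k → Matrix κ ι ℂ) (hK : ∑ i, (K i).conjTranspose * K i = 1) (X : Matrix ι ι ℂ) :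
    ∑ i, (K i * X * (K i).conjTranspose).trace = X.trace := by
  have h : ∀ i, (K i * X * (K i).conjTranspose).trace
      = (((K i).conjTranspose * K i) * X).trace := fun i => by
    rw [Matrix.trace_mul_comm, Matrix.mul_assoc]
  simp only [h]
  rw [← Matrix.trace_sum, ← Finset.sum_mul, hK, Matrix.one_mul]

theorem IsLOCC.posSemidef_trace {m n a b : ℕ} {Λ : BiMat a b → BiMat m n} (h : IsLOCC Λ) :
    (∀ X, X.PosSemidef → (Λ X).PosSemidef) ∧ ∀ X, (Λ X).trace = X.trace := by
  induction h with
  | finish => exact ⟨fun _ h => h, fun _ => rfl⟩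
  | @alice a b a' k A hA Λ hΛ ih =>
    refine ⟨fun X hX => Matrix.posSemidef_sum _ fun i _ =>
      (ih i).1 _ (hX.mul_mul_conjTranspose_same _), fun X => ?_⟩
    rw [Matrix.trace_sum]
    simp only [(ih _).2]
    refine trace_sum_kraus _ ?_ X
    simp only [Matrix.conjTranspose_kronecker, ← Matrix.mul_kronecker_mul,
      Matrix.conjTranspose_one, Matrix.mul_one]
    rw [← Matrix.one_kronecker_one, ← hA]
    ext i j
    simp [Matrix.sum_apply, Matrix.kroneckerMap_apply, Finset.sum_mul]
  | @bob a b b' k B hB Λ hΛ ih =>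
    refine ⟨fun X hX => Matrix.posSemidef_sum _ fun i _ =>
      (ih i).1 _ (hX.mul_mul_conjTranspose_same _), fun X => ?_⟩
    rw [Matrix.trace_sum]
    simp only [(ih _).2]
    refine trace_sum_kraus _ ?_ X
    simp only [Matrix.conjTranspose_kronecker, ← Matrix.mul_kronecker_mul,
      Matrix.conjTranspose_one, Matrix.mul_one]
    rw [← Matrix.one_kronecker_one, ← hB]
    ext i j
    simp [Matrix.sum_apply, Matrix.kroneckerMap_apply, Finset.mul_sum]

/-- The state `Λ(ρ)`. -/
def State.map {d : ℕ} (Λ : LOCC d) (ρ : State d) : State d :=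
  ⟨Λ.1 ρ.1, Λ.2.posSemidef_trace.1 _ ρ.2.1, (Λ.2.posSemidef_trace.2 _).trans ρ.2.2⟩

/-- The swap unitary `V (φ ⊗ ψ) = ψ ⊗ φ`. -/
def swapV (d : ℕ) : BiMat d d := fun i j => if i = j.swap then 1 else 0

theorem swapV_conjTranspose (d : ℕ) : (swapV d).conjTranspose = swapV d := by
  ext ⟨i, i'⟩ ⟨j, j'⟩
  simp only [swapV, Matrix.conjTranspose_apply, Prod.swap_prod_mk, Prod.mk.injEq]
  have : (j = i' ∧ j' = i) ↔ (i = j' ∧ i' = j) := by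
    constructor <;> rintro ⟨rfl, rfl⟩ <;> exact ⟨rfl, rfl⟩
  simp [this, apply_ite]

theorem swapV_mul_self (d : ℕ) : swapV d * swapV d = 1 := by
  ext i j
  simp [swapV, Matrix.mul_apply, Matrix.one_apply]

/-- The swapped state `VρV`. -/
def State.swap {d : ℕ} (ρ : State d) : State d :=
  ⟨swapV d * ρ.1 * swapV d, by
    have h := ρ.2.1.mul_mul_conjTranspose_same (swapV d)
    rwa [swapV_conjTranspose] at h, by
    rw [Matrix.trace_mul_comm, ← Matrix.mul_assoc, swapV_mul_self, Matrix.one_mul]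
    exact ρ.2.2⟩

/-- `σ` can be swapped by an operation of the class `C`. -/
def SwappableBy {d : ℕ} (C : Set (BiMat d d → BiMat d d)) (σ : State d) : Prop :=
  ∃ Λ ∈ C, Λ σ.1 = σ.swap.1

/-- Separable states: finite mixtures of product states. -/
def IsSeparable {d : ℕ} (ρ : State d) : Prop :=
  ∃ (k : ℕ) (p : Fin k → ℝ) (α β : Fin k → Matrix (Fin d) (Fin d) ℂ),
    (∀ i, 0 ≤ p i) ∧ ∑ i, p i = 1 ∧ (∀ i, IsDensity (α i)) ∧ (∀ i, IsDensity (β i)) ∧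
    ρ.1 = ∑ i, (p i : ℂ) • (α i ⊗ₖ β i)

/-- A continuous, contractive and faithful "distance" on states. Contractivity is only required
for LOCC operations; neither symmetry nor the triangle inequality is required. -/
structure IsContractiveDistance {d : ℕ} (D : State d → State d → ℝ) : Prop where
  continuous : Continuous fun x : State d × State d => D x.1 x.2
  contractive : ∀ (Λ : LOCC d) (ρ τ : State d), D (ρ.map Λ) (τ.map Λ) ≤ D ρ τ
  eq_zero_iff : ∀ ρ τ : State d, D ρ τ = 0 ↔ ρ = τ

/-- `E^D(ρ)`, the infimum of `D(ρ, τ)` over separable states `τ`. -/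
noncomputable def distEnt {d : ℕ} (D : State d → State d → ℝ) (ρ : State d) : ℝ :=
  ⨅ τ : {τ : State d // IsSeparable τ}, D ρ τ.1

/-- `E_σ(ρ) = E^D(σ) - inf_Λ D(σ, Λ(ρ))`, the infimum over LOCC operations `Λ`. -/
noncomputable def asymEnt {d : ℕ} (D : State d → State d → ℝ) (σ ρ : State d) : ℝ :=
  distEnt D σ - ⨅ Λ : LOCC d, D σ (ρ.map Λ)

/-- The operator `|ψ⟩⟨ψ|`. -/
def proj {d : ℕ} (ψ : Fin d × Fin d → ℂ) : BiMat d d := Matrix.vecMulVec ψ (star ψ)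

/-- Partial trace over the second subsystem. -/
def reducedA {d : ℕ} (X : BiMat d d) : Matrix (Fin d) (Fin d) ℂ :=
  fun i j => ∑ k, X (i, k) (j, k)

/-- `G(ψ) = d (det ρ_A)^{1/d}` for a vector `ψ`; homogeneous of degree one in `|ψ⟩⟨ψ|`. -/
noncomputable def gPure {d : ℕ} (ψ : Fin d × Fin d → ℂ) : ℝ :=
  d * (reducedA (proj ψ)).det.re ^ (1 / d : ℝ)

/-- The convex roof of `G`, over decompositions of `ρ` into unnormalised pure states. -/
noncomputable def gConc {d : ℕ} (ρ : State d) : ℝ :=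
  sInf {g | ∃ (k : ℕ) (ψ : Fin k → Fin d × Fin d → ℂ),
    ρ.1 = ∑ i, proj (ψ i) ∧ g = ∑ i, gPure (ψ i)}

/-- The product vector `|ij⟩`. -/
def ket {d : ℕ} (i j : Fin d) : Fin d × Fin d → ℂ := Pi.single (i, j) 1

end AsymEnt

/-!
The infimum in `E_σ(VσV)` runs over LOCC operations, and the closure of LOCC lies in the set
`SEP d` of separable operations. The latter is compact: by
Carathéodory's theorem for cones (`exists_sum_fin_of_sum_mem_cone`) the number of product Kraus
operators is bounded by the dimension only, and after rescaling their factors have entries in the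
unit disc, so that `SEP d` is a continuous image of a compact set (`isCompact_SEP`). Hence the
infimum of `D(σ, Λ(VσV))` is attained on the closure of LOCC, and by faithfulness of `D` it vanishes
exactly when some `Λ` in the closure maps `VσV` to `σ`; conjugation with the swap turns such a map
into one that maps `σ` to `VσV` (`asymEnt_swap_lt_iff`). The other properties of `E_σ` follow from
the closure of LOCC under composition and from the fact that every separable state can be prepared
by LOCC from any input; the latter also gives `D ≥ 0`.

If `G(σ) > 0` and a separable operation with Kraus operators `A i ⊗ B i` swaps `σ`, then pushing
decompositions through it gives `G(σ) ≤ c G(σ)` with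
`c = ∑ i, |det A i|^(2/d) |det B i|^(2/d)` (`one_le_sum_det`). The inequality of arithmetic and
geometric means for the eigenvalues of `(A i)ᴴ A i` and `(B i)ᴴ B i` gives `c ≤ 1`, with equality
only if the nonzero Kraus operators are multiples of local unitaries (`kraus_unitary_of_swap`). Such
a mixture of local unitaries is an LOCC operation, so no closure is needed.

For the two-qubit states, every vector in the range is `x |01⟩ + y φ`, with coefficient determinant
`a b y²`; this gives `G(σ) > 0`, and shows that `|01⟩` is the only product vector in the range. A
local unitary mapping the range of `σ` into that of `VσV` then maps `|01⟩` to `|10⟩`, so it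
exchanges `|00⟩` and `|11⟩` up to phases and maps `φ` to a vector with coefficients of moduli `b`
and `a`, which lies in the range of `VσV` only if `a = b`.
-/

namespace AsymEnt

/-! ### Product Kraus form of LOCC operations -/

theorem kron_conj_mul {a b a' b' m n : ℕ} (A' : Matrix (Fin m) (Fin a') ℂ)
    (B' : Matrix (Fin n) (Fin b') ℂ) (A : Matrix (Fin a') (Fin a) ℂ)
    (B : Matrix (Fin b') (Fin b) ℂ) (X : BiMat a b) :
    (A' ⊗ₖ B') * ((A ⊗ₖ B) * X * (A ⊗ₖ B).conjTranspose) * (A' ⊗ₖ B').conjTranspose =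
      ((A' * A) ⊗ₖ (B' * B)) * X * ((A' * A) ⊗ₖ (B' * B)).conjTranspose := by
  simp only [Matrix.mul_kronecker_mul, Matrix.conjTranspose_mul, Matrix.mul_assoc]

/-- Measurements compose: the second one may depend on the outcome of the first. -/
theorem sum_sigma_kraus {κ κ' κ'' ι : Type} [Fintype κ] [Fintype κ'] [Fintype κ'']
    [DecidableEq κ] [DecidableEq κ'] [Fintype ι] {ι' : ι → Type} [∀ i, Fintype (ι' i)]
    (K : ι → Matrix κ' κ ℂ) (K' : ∀ i, ι' i → Matrix κ'' κ' ℂ)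
    (hK : ∑ i, (K i).conjTranspose * K i = 1)
    (hK' : ∀ i, ∑ j, (K' i j).conjTranspose * K' i j = 1) :
    ∑ s : Σ i, ι' i, (K' s.1 s.2 * K s.1).conjTranspose * (K' s.1 s.2 * K s.1) = 1 := by
  rw [Fintype.sum_sigma, ← hK]
  refine Finset.sum_congr rfl fun i _ => ?_
  calc ∑ j, (K' i j * K i).conjTranspose * (K' i j * K i)
      = (K i).conjTranspose * (∑ j, (K' i j).conjTranspose * K' i j) * K i := by
        simp only [Matrix.conjTranspose_mul, Matrix.mul_sum, Matrix.sum_mul, Matrix.mul_assoc]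
    _ = _ := by rw [hK', Matrix.mul_one]

theorem kron_one_sum {a b a' : ℕ} {ι : Type} [Fintype ι] (A : ι → Matrix (Fin a') (Fin a) ℂ)
    (hA : ∑ i, (A i).conjTranspose * A i = 1) :
    ∑ i, (A i ⊗ₖ (1 : Matrix (Fin b) (Fin b) ℂ)).conjTranspose *
      (A i ⊗ₖ (1 : Matrix (Fin b) (Fin b) ℂ)) = 1 := by
  simp only [Matrix.conjTranspose_kronecker, ← Matrix.mul_kronecker_mul,
    Matrix.conjTranspose_one, Matrix.mul_one]
  rw [← Matrix.one_kronecker_one, ← hA]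
  ext i j
  simp [Matrix.sum_apply, Matrix.kroneckerMap_apply, Finset.sum_mul]

theorem one_kron_sum {a b b' : ℕ} {ι : Type} [Fintype ι] (B : ι → Matrix (Fin b') (Fin b) ℂ)
    (hB : ∑ i, (B i).conjTranspose * B i = 1) :
    ∑ i, ((1 : Matrix (Fin a) (Fin a) ℂ) ⊗ₖ B i).conjTranspose *
      ((1 : Matrix (Fin a) (Fin a) ℂ) ⊗ₖ B i) = 1 := by
  simp only [Matrix.conjTranspose_kronecker, ← Matrix.mul_kronecker_mul,
    Matrix.conjTranspose_one, Matrix.mul_one]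
  rw [← Matrix.one_kronecker_one, ← hB]
  ext i j
  simp [Matrix.sum_apply, Matrix.kroneckerMap_apply, Finset.mul_sum]

/-- Every LOCC operation is a trace preserving separable operation, between systems of any
dimensions. -/
theorem IsLOCC.exists_kraus {m n a b : ℕ} {Λ : BiMat a b → BiMat m n} (h : IsLOCC Λ) :
    ∃ (ι : Type) (_ : Fintype ι) (A : ι → Matrix (Fin m) (Fin a) ℂ)
      (B : ι → Matrix (Fin n) (Fin b) ℂ),
      ∑ i, (A i ⊗ₖ B i).conjTranspose * (A i ⊗ₖ B i) = 1 ∧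
      ∀ X, Λ X = ∑ i, (A i ⊗ₖ B i) * X * (A i ⊗ₖ B i).conjTranspose := by
  induction h with
  | finish => exact ⟨Unit, inferInstance, fun _ => 1, fun _ => 1, by simp, by simp⟩
  | @alice a b a' k A hA Λ hΛ ih =>
    choose ι hι A' B' h1 h2 using ih
    refine ⟨Σ i, ι i, inferInstance, fun s => A' s.1 s.2 * A s.1,
      fun s => B' s.1 s.2 * (1 : Matrix (Fin b) (Fin b) ℂ), ?_,
      fun X => ?_⟩
    · have := sum_sigma_kraus (fun i => A i ⊗ₖ (1 : Matrix (Fin b) (Fin b) ℂ))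
        (fun i j => A' i j ⊗ₖ B' i j) (kron_one_sum A hA) h1
      simpa only [← Matrix.mul_kronecker_mul] using this
    · simp only [h2, kron_conj_mul, Fintype.sum_sigma]
  | @bob a b b' k B hB Λ hΛ ih =>
    choose ι hι A' B' h1 h2 using ih
    refine ⟨Σ i, ι i, inferInstance, fun s => A' s.1 s.2 * (1 : Matrix (Fin a) (Fin a) ℂ),
      fun s => B' s.1 s.2 * B s.1, ?_,
      fun X => ?_⟩
    · have := sum_sigma_kraus (fun i => (1 : Matrix (Fin a) (Fin a) ℂ) ⊗ₖ B i)
        (fun i j => A' i j ⊗ₖ B' i j) (one_kron_sum B hB) h1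
      simpa only [← Matrix.mul_kronecker_mul] using this
    · simp only [h2, kron_conj_mul, Fintype.sum_sigma]

theorem LOCC_subset_SEP (d : ℕ) : LOCC d ⊆ SEP d := by
  intro Λ hΛ
  obtain ⟨ι, _, A, B, h1, h2⟩ := IsLOCC.exists_kraus hΛ
  let e := Fintype.equivFin ι
  refine ⟨Fintype.card ι, A ∘ e.symm, B ∘ e.symm, ?_, fun X => ?_⟩
  · rw [← h1]
    exact e.symm.sum_comp fun i => (A i ⊗ₖ B i).conjTranspose * (A i ⊗ₖ B i)
  · rw [h2]
    exact (e.symm.sum_comp fun i => (A i ⊗ₖ B i) * X * (A i ⊗ₖ B i).conjTranspose).symm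

theorem IsLOCC.map_sum {m n a b : ℕ} {Λ : BiMat a b → BiMat m n} (h : IsLOCC Λ)
    {κ : Type} [Fintype κ] (X : κ → BiMat a b) : Λ (∑ k, X k) = ∑ k, Λ (X k) := by
  obtain ⟨ι, _, A, B, -, h2⟩ := h.exists_kraus
  simp only [h2, Matrix.mul_sum, Matrix.sum_mul]
  exact Finset.sum_comm

/-! ### Closure properties of LOCC -/

theorem IsLOCC.congr {m n a b : ℕ} {Λ Λ' : BiMat a b → BiMat m n} (h : IsLOCC Λ)
    (h' : ∀ X, Λ' X = Λ X) : IsLOCC Λ' := by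
  rwa [funext h']

theorem IsLOCC.comp {m n m' n' a b : ℕ} {Λ : BiMat a b → BiMat m n}
    {Λ' : BiMat m n → BiMat m' n'} (h' : IsLOCC Λ') (h : IsLOCC Λ) :
    IsLOCC fun X => Λ' (Λ X) := by
  induction h with
  | finish => exact h'
  | alice A hA Λ hΛ ih => exact (IsLOCC.alice A hA _ fun i => ih i).congr fun X => h'.map_sum _
  | bob B hB Λ hΛ ih => exact (IsLOCC.bob B hB _ fun i => ih i).congr fun X => h'.map_sum _

/-- A local measurement by the first party, with outcomes in any finite type. -/
theorem isLOCC_alice {a b a' m n : ℕ} {ι : Type} [Fintype ι] (A : ι → Matrix (Fin a') (Fin a) ℂ)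
    (hA : ∑ i, (A i).conjTranspose * A i = 1)
    (Λ : ι → BiMat a' b → BiMat m n) (hΛ : ∀ i, IsLOCC (Λ i)) :
    IsLOCC (fun X : BiMat a b => ∑ i, Λ i ((A i ⊗ₖ (1 : Matrix (Fin b) (Fin b) ℂ)) * X *
      (A i ⊗ₖ (1 : Matrix (Fin b) (Fin b) ℂ)).conjTranspose)) := by
  let e := Fintype.equivFin ι
  refine (IsLOCC.alice (fun i => A (e.symm i)) ?_ (fun i => Λ (e.symm i)) fun i => hΛ _).congr
    fun X => ?_
  · rw [← hA]
    exact e.symm.sum_comp fun i => (A i).conjTranspose * A i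
  · exact (e.symm.sum_comp fun i => Λ i ((A i ⊗ₖ (1 : Matrix (Fin b) (Fin b) ℂ)) * X *
      (A i ⊗ₖ (1 : Matrix (Fin b) (Fin b) ℂ)).conjTranspose)).symm

/-- A local measurement by the second party, with outcomes in any finite type. -/
theorem isLOCC_bob {a b b' m n : ℕ} {ι : Type} [Fintype ι] (B : ι → Matrix (Fin b') (Fin b) ℂ)
    (hB : ∑ i, (B i).conjTranspose * B i = 1)
    (Λ : ι → BiMat a b' → BiMat m n) (hΛ : ∀ i, IsLOCC (Λ i)) :
    IsLOCC (fun X : BiMat a b => ∑ i, Λ i (((1 : Matrix (Fin a) (Fin a) ℂ) ⊗ₖ B i) * X *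
      ((1 : Matrix (Fin a) (Fin a) ℂ) ⊗ₖ B i).conjTranspose)) := by
  let e := Fintype.equivFin ι
  refine (IsLOCC.bob (fun i => B (e.symm i)) ?_ (fun i => Λ (e.symm i)) fun i => hΛ _).congr
    fun X => ?_
  · rw [← hB]
    exact e.symm.sum_comp fun i => (B i).conjTranspose * B i
  · exact (e.symm.sum_comp fun i => Λ i (((1 : Matrix (Fin a) (Fin a) ℂ) ⊗ₖ B i) * X *
      ((1 : Matrix (Fin a) (Fin a) ℂ) ⊗ₖ B i).conjTranspose)).symm

/-- Exchange of the two tensor factors. -/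
def flip {a b : ℕ} (X : BiMat a b) : BiMat b a := X.submatrix Prod.swap Prod.swap

theorem flip_flip {a b : ℕ} (X : BiMat a b) : flip (flip X) = X := rfl

theorem flip_sum {a b : ℕ} {ι : Type} [Fintype ι] (X : ι → BiMat a b) :
    flip (∑ i, X i) = ∑ i, flip (X i) := by
  ext i j
  simp [flip, Matrix.sum_apply]

theorem flip_kron_conj {a b m n : ℕ} (A : Matrix (Fin m) (Fin a) ℂ) (B : Matrix (Fin n) (Fin b) ℂ)
    (X : BiMat a b) :
    flip ((A ⊗ₖ B) * X * (A ⊗ₖ B).conjTranspose) =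
      (B ⊗ₖ A) * flip X * (B ⊗ₖ A).conjTranspose := by
  have h : ∀ {m n a b : ℕ} (A : Matrix (Fin m) (Fin a) ℂ) (B : Matrix (Fin n) (Fin b) ℂ),
      (A ⊗ₖ B).submatrix Prod.swap Prod.swap = B ⊗ₖ A := fun A B => by
    ext i j
    simp [Matrix.kroneckerMap_apply, mul_comm]
  have e : (Prod.swap : Fin b × Fin a → _) = Equiv.prodComm (Fin b) (Fin a) := rfl
  rw [← h A B, Matrix.conjTranspose_submatrix, flip, flip, e, Matrix.submatrix_mul_equiv,
    Matrix.submatrix_mul_equiv]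

theorem swapV_conj {d : ℕ} (X : BiMat d d) : swapV d * X * swapV d = flip X := by
  have h : ∀ i j : Fin d × Fin d, (i = j.swap) = (j = i.swap) := fun i j => by
    rw [eq_iff_iff]
    constructor <;> rintro rfl <;> simp
  ext i j
  simp [swapV, Matrix.mul_apply, flip, h i]

theorem IsLOCC.flip {m n a b : ℕ} {Λ : BiMat a b → BiMat m n} (h : IsLOCC Λ) :
    IsLOCC fun X : BiMat b a => AsymEnt.flip (Λ (AsymEnt.flip X)) := by
  induction h with
  | finish => exact IsLOCC.finish
  | alice A hA Λ hΛ ih =>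
    refine (IsLOCC.bob A hA _ fun i => ih i).congr fun X => ?_
    simp only [flip_sum, flip_kron_conj]
  | bob B hB Λ hΛ ih =>
    refine (IsLOCC.alice B hB _ fun i => ih i).congr fun X => ?_
    simp only [flip_sum, flip_kron_conj]

/-! ### Preparation of separable states -/

/-- Shared randomness: a convex mixture of LOCC operations is LOCC. -/
theorem isLOCC_mix {a b m n k : ℕ} (p : Fin k → ℝ) (hp : ∀ i, 0 ≤ p i) (hp1 : ∑ i, p i = 1)
    (Λ : Fin k → BiMat a b → BiMat m n) (hΛ : ∀ i, IsLOCC (Λ i)) :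
    IsLOCC fun X => ∑ i, Λ i ((p i : ℂ) • X) := by
  have hs : ∀ i, ((√(p i) : ℝ) : ℂ) * ((√(p i) : ℝ) : ℂ) = (p i : ℂ) := fun i => by
    rw [← Complex.ofReal_mul, Real.mul_self_sqrt (hp i)]
  refine (IsLOCC.alice (fun i => ((√(p i) : ℝ) : ℂ) • (1 : Matrix (Fin a) (Fin a) ℂ)) ?_ Λ
    hΛ).congr fun X => ?_
  · simp only [Matrix.conjTranspose_smul, Matrix.conjTranspose_one, Matrix.smul_mul,
      Matrix.mul_smul, Matrix.one_mul, smul_smul, Complex.star_def, Complex.conj_ofReal, hs]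
    rw [← Finset.sum_smul, ← Complex.ofReal_sum, hp1, Complex.ofReal_one, one_smul]
  · simp only [Matrix.smul_kronecker, Matrix.one_kronecker_one, Matrix.conjTranspose_smul,
      Matrix.conjTranspose_one, Matrix.smul_mul, Matrix.mul_smul, Matrix.one_mul, Matrix.mul_one,
      smul_smul, Complex.star_def, Complex.conj_ofReal, hs]

/-- The Kraus operators `C |j⟩⟨k|` discard a system and prepare the state `C Cᴴ`. -/
theorem prepare_kraus {d : ℕ} (C : Matrix (Fin d) (Fin d) ℂ)
    (hC : (C * C.conjTranspose).trace = 1) :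
    ∑ s : Fin d × Fin d, (C * Matrix.single s.1 s.2 1).conjTranspose *
      (C * Matrix.single s.1 s.2 1) = 1 := by
  ext i j
  rw [Matrix.trace_mul_comm] at hC
  simp only [Matrix.sum_apply, Matrix.mul_apply, Matrix.conjTranspose_apply, Matrix.single_apply,
    Fintype.sum_prod_type]
  simp only [Matrix.trace, Matrix.diag, Matrix.mul_apply, Matrix.conjTranspose_apply] at hC
  simp [Matrix.one_apply, ite_and]
  by_cases h : i = j
  · subst h; simpa using hC
  · simp [h, Ne.symm h]

theorem sum_single_kron_conj {d : ℕ} (X : BiMat d d) :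
    ∑ s : Fin d × Fin d,
      (Matrix.single s.1 s.2 (1 : ℂ) ⊗ₖ (1 : Matrix (Fin d) (Fin d) ℂ)) * X *
      (Matrix.single s.1 s.2 (1 : ℂ) ⊗ₖ (1 : Matrix (Fin d) (Fin d) ℂ)).conjTranspose =
    (1 : Matrix (Fin d) (Fin d) ℂ) ⊗ₖ (Matrix.of fun u v => ∑ k, X (k, u) (k, v)) := by
  ext ⟨x, u⟩ ⟨y, v⟩
  simp only [Matrix.sum_apply, Matrix.mul_apply, Matrix.conjTranspose_apply,
    Matrix.kroneckerMap_apply, Matrix.single_apply, Fintype.sum_prod_type, Matrix.one_apply]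
  simp [ite_and, apply_ite (starRingEnd ℂ)]
  by_cases h : x = y
  · subst h; simp
  · simp [h, Ne.symm h]

theorem sum_single_conj {d : ℕ} (Y : Matrix (Fin d) (Fin d) ℂ) :
    ∑ s : Fin d × Fin d, Matrix.single s.1 s.2 (1 : ℂ) * Y *
      (Matrix.single s.1 s.2 (1 : ℂ)).conjTranspose = Y.trace • 1 := by
  ext x y
  simp only [Matrix.sum_apply, Matrix.mul_apply, Matrix.conjTranspose_apply,
    Matrix.single_apply, Fintype.sum_prod_type, Matrix.one_apply, Matrix.smul_apply, Matrix.trace,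
    Matrix.diag]
  simp [ite_and]
  by_cases h : x = y
  · subst h; simp
  · simp [h]

open scoped MatrixOrder in
theorem IsDensity.exists_factor {d : ℕ} {α : Matrix (Fin d) (Fin d) ℂ} (h : IsDensity α) :
    ∃ C : Matrix (Fin d) (Fin d) ℂ, C * C.conjTranspose = α := by
  obtain ⟨B, hB⟩ := CStarAlgebra.nonneg_iff_eq_star_mul_self.mp h.1.nonneg
  exact ⟨B.conjTranspose, by rw [Matrix.conjTranspose_conjTranspose, hB,
    Matrix.star_eq_conjTranspose]⟩

/-- Both parties may discard their systems and prepare a product state. -/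
theorem isLOCC_prepare_product {d : ℕ} {α β : Matrix (Fin d) (Fin d) ℂ} (hα : IsDensity α)
    (hβ : IsDensity β) : IsLOCC fun X : BiMat d d => X.trace • (α ⊗ₖ β) := by
  obtain ⟨C, rfl⟩ := hα.exists_factor
  obtain ⟨E, rfl⟩ := hβ.exists_factor
  refine (isLOCC_alice (fun s : Fin d × Fin d => C * Matrix.single s.1 s.2 1)
    (prepare_kraus C hα.2) _ fun _ => isLOCC_bob (fun s : Fin d × Fin d =>
      E * Matrix.single s.1 s.2 1) (prepare_kraus E hβ.2) _ fun _ => IsLOCC.finish).congr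
    fun X => ?_
  have hA : ∑ s : Fin d × Fin d,
      ((C * Matrix.single s.1 s.2 1) ⊗ₖ (1 : Matrix (Fin d) (Fin d) ℂ)) * X *
      ((C * Matrix.single s.1 s.2 1) ⊗ₖ (1 : Matrix (Fin d) (Fin d) ℂ)).conjTranspose =
      (C * C.conjTranspose) ⊗ₖ (Matrix.of fun u v => ∑ k, X (k, u) (k, v)) := by
    have := congrArg (fun Z => (C ⊗ₖ (1 : Matrix (Fin d) (Fin d) ℂ)) * Z *
      (C ⊗ₖ (1 : Matrix (Fin d) (Fin d) ℂ)).conjTranspose) (sum_single_kron_conj X)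
    simp only [Matrix.mul_sum, Matrix.sum_mul, kron_conj_mul, Matrix.one_mul] at this
    rw [this, Matrix.conjTranspose_kronecker, ← Matrix.mul_kronecker_mul,
      ← Matrix.mul_kronecker_mul, Matrix.conjTranspose_one, Matrix.mul_one, Matrix.one_mul,
      Matrix.mul_one]
  rw [Finset.sum_comm]
  simp only [← Matrix.sum_mul, ← Matrix.mul_sum, hA]
  simp only [Matrix.conjTranspose_kronecker, ← Matrix.mul_kronecker_mul, Matrix.conjTranspose_one,
    Matrix.mul_one, Matrix.one_mul]
  have hB := congrArg (fun Z => E * Z * E.conjTranspose)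
    (sum_single_conj (Matrix.of fun u v => ∑ k, X (k, u) (k, v)))
  have ht : (Matrix.of fun u v => ∑ k, X (k, u) (k, v)).trace = X.trace := by
    simp only [Matrix.trace, Matrix.diag, Matrix.of_apply, Fintype.sum_prod_type]
    exact Finset.sum_comm
  simp only [ht, Matrix.mul_sum, Matrix.sum_mul, Matrix.mul_smul, Matrix.smul_mul,
    Matrix.mul_one] at hB
  rw [← Matrix.kronecker_smul, ← hB]
  ext i j
  simp [Matrix.sum_apply, Matrix.kroneckerMap_apply, Finset.mul_sum, Matrix.conjTranspose_mul,
    Matrix.mul_assoc]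

/-- The constant map to a separable state is an LOCC operation. -/
theorem exists_LOCC_const {d : ℕ} {τ : State d} (hτ : IsSeparable τ) :
    ∃ Λ : LOCC d, ∀ ρ : State d, ρ.map Λ = τ := by
  obtain ⟨k, p, α, β, hp, hp1, hα, hβ, h⟩ := hτ
  refine ⟨⟨_, isLOCC_mix p hp hp1 _ fun i => isLOCC_prepare_product (hα i) (hβ i)⟩, fun ρ => ?_⟩
  apply Subtype.ext
  simp [State.map, h, Matrix.trace_smul, ρ.2.2]

/-! ### LOCC preserves separability -/

theorem IsDensity.exists_smul {d : ℕ} {P δ : Matrix (Fin d) (Fin d) ℂ} (hδ : IsDensity δ)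
    (hP : P.PosSemidef) : ∃ (t : ℝ) (α : Matrix (Fin d) (Fin d) ℂ),
      0 ≤ t ∧ IsDensity α ∧ P = (t : ℂ) • α := by
  have h0 := hP.trace_nonneg
  rw [Complex.nonneg_iff] at h0
  have ht : P.trace = (P.trace.re : ℂ) := Complex.ext rfl (by simp [← h0.2])
  by_cases h : P.trace = 0
  · exact ⟨0, δ, le_rfl, hδ, by simpa using hP.trace_eq_zero_iff.mp h⟩
  · refine ⟨P.trace.re, (P.trace)⁻¹ • P, h0.1, ⟨?_, ?_⟩, ?_⟩
    · refine hP.smul ?_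
      rw [ht, ← Complex.ofReal_inv]
      exact Complex.zero_le_real.mpr (inv_nonneg.mpr h0.1)
    · rw [Matrix.trace_smul, smul_eq_mul, inv_mul_cancel₀ h]
    · rw [← ht, smul_smul, mul_inv_cancel₀ h, one_smul]

theorem isSeparable_of_sum {d : ℕ} {ρ : State d} {ι : Type} [Fintype ι]
    {δ : Matrix (Fin d) (Fin d) ℂ} (hδ : IsDensity δ)
    (P Q : ι → Matrix (Fin d) (Fin d) ℂ) (hP : ∀ i, (P i).PosSemidef) (hQ : ∀ i, (Q i).PosSemidef)
    (h : ρ.1 = ∑ i, P i ⊗ₖ Q i) : IsSeparable ρ := by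
  choose t α ht hα hPα using fun i => hδ.exists_smul (hP i)
  choose u β hu hβ hQβ using fun i => hδ.exists_smul (hQ i)
  have h' : ρ.1 = ∑ i, ((t i * u i : ℝ) : ℂ) • (α i ⊗ₖ β i) := by
    rw [h]
    refine Finset.sum_congr rfl fun i _ => ?_
    rw [hPα, hQβ, Matrix.smul_kronecker, Matrix.kronecker_smul, smul_smul, Complex.ofReal_mul]
  let e := Fintype.equivFin ι
  refine ⟨Fintype.card ι, fun i => t (e.symm i) * u (e.symm i), fun i => α (e.symm i),
    fun i => β (e.symm i), fun i => mul_nonneg (ht _) (hu _), ?_, fun i => hα _, fun i => hβ _, ?_⟩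
  · rw [e.symm.sum_comp fun i => t i * u i]
    have := ρ.2.2
    rw [h', Matrix.trace_sum] at this
    simp only [Matrix.trace_smul, Matrix.trace_kronecker, (hα _).2, (hβ _).2, smul_eq_mul,
      mul_one] at this
    exact_mod_cast this
  · rw [h', e.symm.sum_comp fun i => ((t i * u i : ℝ) : ℂ) • (α i ⊗ₖ β i)]

theorem IsSeparable.map {d : ℕ} {ρ : State d} (hρ : IsSeparable ρ) (Λ : LOCC d) :
    IsSeparable (ρ.map Λ) := by
  obtain ⟨k, p, α, β, hp, hp1, hα, hβ, h⟩ := hρ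
  obtain ⟨ι, _, A, B, -, hΛ⟩ := IsLOCC.exists_kraus Λ.2
  obtain ⟨i₀⟩ : Nonempty (Fin k) := by
    by_contra hk
    rw [not_nonempty_iff] at hk
    simp at hp1
  refine isSeparable_of_sum (ι := ι × Fin k) (hα i₀)
    (fun s => (p s.2 : ℂ) • (A s.1 * α s.2 * (A s.1).conjTranspose))
    (fun s => B s.1 * β s.2 * (B s.1).conjTranspose)
    (fun s => ((hα _).1.mul_mul_conjTranspose_same _).smul (Complex.zero_le_real.mpr (hp _)))
    (fun s => (hβ _).1.mul_mul_conjTranspose_same _) ?_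
  change Λ.1 ρ.1 = _
  rw [hΛ, h, Fintype.sum_prod_type]
  simp only [Matrix.mul_sum, Matrix.sum_mul, Matrix.conjTranspose_kronecker, Matrix.mul_smul,
    Matrix.smul_mul, Matrix.smul_kronecker, Matrix.mul_kronecker_mul]


/-! ### Compactness of the set of separable operations -/

/-- Carathéodory's theorem for cones: in a real vector space of finite dimension, a sum of
elements of a cone is a sum of at most `finrank + 1` of its elements. -/
theorem exists_sum_fin_of_sum_mem_cone {E : Type} [AddCommGroup E] [Module ℝ E]
    [FiniteDimensional ℝ E] {S : Set E} (h0 : (0 : E) ∈ S)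
    (hS : ∀ t : ℝ, 0 ≤ t → ∀ x ∈ S, t • x ∈ S) {k : ℕ} (v : Fin k → E) (hv : ∀ i, v i ∈ S) :
    ∃ z : Fin (Module.finrank ℝ E + 1) → E, (∀ i, z i ∈ S) ∧ ∑ i, z i = ∑ i, v i := by
  have hx : ∑ i, v i ∈ convexHull ℝ S := by
    rcases Nat.eq_zero_or_pos k with rfl | hk
    · simpa using subset_convexHull ℝ S h0
    · have hk' : (k : ℝ) ≠ 0 := by positivity
      have : ∑ i, v i = ∑ i, (k : ℝ)⁻¹ • ((k : ℝ) • v i) := by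
        simp [smul_smul, inv_mul_cancel₀ hk']
      rw [this]
      refine (convex_convexHull ℝ S).sum_mem (fun _ _ => by positivity) (by simp [hk'])
        fun i _ => subset_convexHull ℝ S (hS _ (by positivity) _ (hv i))
  obtain ⟨κ, _, z, w, hz, haff, hw, -, hsum⟩ := eq_pos_convex_span_of_mem_convexHull hx
  have hcard : Fintype.card κ ≤ Module.finrank ℝ E + 1 :=
    haff.card_le_finrank_succ.trans (Nat.add_le_add_right (Submodule.finrank_le _) 1)
  obtain ⟨e⟩ : Nonempty (κ ↪ Fin (Module.finrank ℝ E + 1)) :=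
    Function.Embedding.nonempty_of_card_le (by simpa using hcard)
  refine ⟨Function.extend e (fun j => w j • z j) 0, fun i => ?_, ?_⟩
  · by_cases hi : ∃ j, e j = i
    · obtain ⟨j, rfl⟩ := hi
      rw [e.injective.extend_apply]
      exact hS _ (hw j).le _ (hz ⟨j, rfl⟩)
    · rw [Function.extend_apply' _ _ _ hi]
      exact h0
  · rw [← hsum]
    refine (Fintype.sum_of_injective e e.injective _ _ (fun i hi => ?_) fun j => ?_).symm
    · rw [Function.extend_apply' _ _ _ hi]; rfl
    · rw [e.injective.extend_apply]

/-- The coefficients of `X ↦ K X Kᴴ`, an array depending on the map only. -/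
def choi {ι : Type} (K : Matrix ι ι ℂ) : ι → ι → ι → ι → ℂ :=
  fun x k y l => K x k * star (K y l)

theorem sum_conj_eq_choi {ι κ : Type} [Fintype ι] [Fintype κ] (K : κ → Matrix ι ι ℂ)
    (X : Matrix ι ι ℂ) : ∑ i, K i * X * (K i).conjTranspose =
      Matrix.of fun x y => ∑ l, ∑ k, X k l * (∑ i, choi (K i)) x k y l := by
  ext x y
  simp only [Matrix.sum_apply, Matrix.mul_apply, Matrix.conjTranspose_apply, Matrix.of_apply,
    Finset.sum_apply, choi, Finset.mul_sum, Finset.sum_mul]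
  rw [Finset.sum_comm]
  refine Finset.sum_congr rfl fun l _ => ?_
  rw [Finset.sum_comm]
  exact Finset.sum_congr rfl fun k _ => Finset.sum_congr rfl fun i _ => by ring

theorem sum_adjoint_mul_eq_choi {ι κ : Type} [Fintype ι] [Fintype κ] (K : κ → Matrix ι ι ℂ) :
    ∑ i, (K i).conjTranspose * K i = Matrix.of fun k l => ∑ x, (∑ i, choi (K i)) x l x k := by
  ext k l
  simp only [Matrix.sum_apply, Matrix.mul_apply, Matrix.conjTranspose_apply, Matrix.of_apply,
    Finset.sum_apply, choi]
  rw [Finset.sum_comm]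
  exact Finset.sum_congr rfl fun x _ => Finset.sum_congr rfl fun i _ => mul_comm _ _

/-- The factors of `A ⊗ B` can be rescaled so that `A` has entries of modulus at most one and the
entries of `B` are dominated by those of `A ⊗ B`. -/
theorem exists_kron_normalized {d : ℕ} (A B : Matrix (Fin d) (Fin d) ℂ) :
    ∃ A' B' : Matrix (Fin d) (Fin d) ℂ, A' ⊗ₖ B' = A ⊗ₖ B ∧ (∀ x y, ‖A' x y‖ ≤ 1) ∧
      ∀ u v, ∃ x y, ‖B' u v‖ ≤ ‖(A' ⊗ₖ B') (x, u) (y, v)‖ := by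
  by_cases hA : A = 0
  · exact ⟨0, 0, by simp [hA], by simp, fun u v => ⟨u, v, by simp⟩⟩
  obtain ⟨x₁, y₁, h₁⟩ : ∃ x y, A x y ≠ 0 := by
    by_contra! h
    exact hA (Matrix.ext h)
  obtain ⟨⟨x₀, y₀⟩, -, hmax⟩ := Finset.exists_max_image
    (Finset.univ : Finset (Fin d × Fin d)) (fun s => ‖A s.1 s.2‖) ⟨(x₁, y₁), Finset.mem_univ _⟩
  have hpos : 0 < ‖A x₀ y₀‖ := (norm_pos_iff.mpr h₁).trans_le (hmax (x₁, y₁) (Finset.mem_univ _))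
  have hne : A x₀ y₀ ≠ 0 := norm_pos_iff.mp hpos
  refine ⟨(A x₀ y₀)⁻¹ • A, A x₀ y₀ • B, ?_, fun x y => ?_, fun u v => ⟨x₀, y₀, ?_⟩⟩
  · rw [Matrix.smul_kronecker, Matrix.kronecker_smul, smul_smul, inv_mul_cancel₀ hne, one_smul]
  · rw [Matrix.smul_apply, smul_eq_mul, norm_mul, norm_inv, inv_mul_le_iff₀ hpos, mul_one]
    exact hmax (x, y) (Finset.mem_univ _)
  · change _ ≤ ‖(A x₀ y₀)⁻¹ * A x₀ y₀ * (A x₀ y₀ • B) u v‖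
    rw [inv_mul_cancel₀ hne, one_mul]

/-- Kraus operators of a trace preserving map have entries of modulus at most one. -/
theorem norm_entry_le_one {ι κ : Type} [Fintype ι] [DecidableEq ι] [Fintype κ]
    {K : κ → Matrix ι ι ℂ}
    (hK : ∑ i, (K i).conjTranspose * K i = 1) (i : κ) (x y : ι) : ‖K i x y‖ ≤ 1 := by
  have h := congrFun (congrFun hK y) y
  simp only [Matrix.sum_apply, Matrix.mul_apply, Matrix.conjTranspose_apply, Matrix.one_apply_eq,
    Complex.star_def, Complex.conj_mul'] at h
  have h' : ∑ i, ∑ x, ‖K i x y‖ ^ 2 = 1 := by exact_mod_cast h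
  have h1 : ‖K i x y‖ ^ 2 ≤ ∑ x, ‖K i x y‖ ^ 2 :=
    Finset.single_le_sum (f := fun x => ‖K i x y‖ ^ 2) (fun _ _ => by positivity)
      (Finset.mem_univ x)
  have h2 : ∑ x, ‖K i x y‖ ^ 2 ≤ ∑ i, ∑ x, ‖K i x y‖ ^ 2 :=
    Finset.single_le_sum (f := fun i => ∑ x, ‖K i x y‖ ^ 2) (fun _ _ => by positivity)
      (Finset.mem_univ i)
  exact (sq_le_one_iff₀ (norm_nonneg _)).mp (h' ▸ h1.trans h2)

/-- The pairs of factors of product Kraus operators, normalised to have entries of modulus at most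
one. -/
def krausFactors (d N : ℕ) : Set (Fin N → Matrix (Fin d) (Fin d) ℂ × Matrix (Fin d) (Fin d) ℂ) :=
  {F | ∑ i, ((F i).1 ⊗ₖ (F i).2).conjTranspose * ((F i).1 ⊗ₖ (F i).2) = 1} ∩
    Set.univ.pi fun _ =>
      (Set.univ.pi fun _ => Set.univ.pi fun _ => Metric.closedBall (0 : ℂ) 1) ×ˢ
        (Set.univ.pi fun _ => Set.univ.pi fun _ => Metric.closedBall (0 : ℂ) 1)

/-- The separable map with the given factors of Kraus operators. -/
def sepMap {d N : ℕ} (F : Fin N → Matrix (Fin d) (Fin d) ℂ × Matrix (Fin d) (Fin d) ℂ)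
    (X : BiMat d d) : BiMat d d :=
  ∑ i, ((F i).1 ⊗ₖ (F i).2) * X * ((F i).1 ⊗ₖ (F i).2).conjTranspose

theorem continuous_kron {d N : ℕ} (i : Fin N) :
    Continuous fun F : Fin N → Matrix (Fin d) (Fin d) ℂ × Matrix (Fin d) (Fin d) ℂ =>
      (F i).1 ⊗ₖ (F i).2 := by
  have h1 : Continuous fun F : Fin N → Matrix (Fin d) (Fin d) ℂ × Matrix (Fin d) (Fin d) ℂ =>
    (F i).1 := by fun_prop
  have h2 : Continuous fun F : Fin N → Matrix (Fin d) (Fin d) ℂ × Matrix (Fin d) (Fin d) ℂ =>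
    (F i).2 := by fun_prop
  exact continuous_matrix fun x y => (h1.matrix_elem _ _).mul (h2.matrix_elem _ _)

theorem isCompact_krausFactors (d N : ℕ) : IsCompact (krausFactors d N) := by
  refine IsCompact.inter_left (isCompact_univ_pi fun _ => IsCompact.prod
    (isCompact_univ_pi fun _ => isCompact_univ_pi fun _ => isCompact_closedBall _ _)
    (isCompact_univ_pi fun _ => isCompact_univ_pi fun _ => isCompact_closedBall _ _)) ?_
  exact isClosed_eq (continuous_finsetSum _ fun i _ =>
    (continuous_kron i).matrix_conjTranspose.matrix_mul (continuous_kron i)) continuous_const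

theorem continuous_sepMap (d N : ℕ) : Continuous (sepMap (d := d) (N := N)) :=
  continuous_pi fun _ => continuous_finsetSum _ fun i _ =>
    ((continuous_kron i).matrix_mul continuous_const).matrix_mul
      (continuous_kron i).matrix_conjTranspose

theorem SEP_eq_image (d : ℕ) : ∃ N : ℕ, SEP d = sepMap '' krausFactors d N := by
  let ι := Fin d × Fin d
  refine ⟨Module.finrank ℝ (ι → ι → ι → ι → ℂ) + 1, Set.Subset.antisymm ?_ ?_⟩
  · rintro Λ ⟨k, A, B, h1, hΛ⟩
    obtain ⟨z, hz, hsum⟩ := exists_sum_fin_of_sum_mem_cone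
      (S := {c : ι → ι → ι → ι → ℂ | ∃ A B : Matrix (Fin d) (Fin d) ℂ, c = choi (A ⊗ₖ B)})
      ⟨0, 0, by ext; simp [choi]⟩ (by
        rintro t ht _ ⟨A, B, rfl⟩
        refine ⟨((√t : ℝ) : ℂ) • A, B, ?_⟩
        ext x k y l
        have : ((√t : ℝ) : ℂ) * ((√t : ℝ) : ℂ) = t := by
          rw [← Complex.ofReal_mul, Real.mul_self_sqrt ht]
        simp only [choi, Matrix.smul_kronecker, Matrix.smul_apply, smul_eq_mul, star_mul',
          Complex.star_def, Complex.conj_ofReal, Pi.smul_apply, Complex.real_smul]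
        rw [← this]
        ring)
      (fun i => choi (A i ⊗ₖ B i)) fun i => ⟨A i, B i, rfl⟩
    choose A₁ B₁ hAB using hz
    choose A' B' hAB' hA' hB' using fun i => exists_kron_normalized (A₁ i) (B₁ i)
    have hc : ∑ i, choi (A' i ⊗ₖ B' i) = ∑ i, choi (A i ⊗ₖ B i) := by
      simp only [hAB', ← hAB, hsum]
    have h1' : ∑ i, (A' i ⊗ₖ B' i).conjTranspose * (A' i ⊗ₖ B' i) = 1 := by
      rw [sum_adjoint_mul_eq_choi, hc, ← sum_adjoint_mul_eq_choi, h1]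
    refine ⟨fun i => (A' i, B' i), ⟨h1', ?_⟩, ?_⟩
    · refine fun i _ => ⟨fun x _ y _ => mem_closedBall_zero_iff.mpr (hA' i x y),
        fun u _ v _ => mem_closedBall_zero_iff.mpr ?_⟩
      obtain ⟨x, y, hxy⟩ := hB' i u v
      exact hxy.trans (norm_entry_le_one h1' i _ _)
    · funext X
      rw [hΛ, sepMap, sum_conj_eq_choi, sum_conj_eq_choi, hc]
  · rintro _ ⟨F, ⟨hF, -⟩, rfl⟩
    exact ⟨_, fun i => (F i).1, fun i => (F i).2, hF, fun X => rfl⟩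

theorem isCompact_SEP (d : ℕ) : IsCompact (SEP d) := by
  obtain ⟨N, h⟩ := SEP_eq_image d
  rw [h]
  exact (isCompact_krausFactors d N).image (continuous_sepMap d N)

theorem closure_LOCC_subset_SEP (d : ℕ) : closure (LOCC d) ⊆ SEP d :=
  closure_minimal (LOCC_subset_SEP d) (isCompact_SEP d).isClosed

theorem isCompact_closure_LOCC (d : ℕ) : IsCompact (closure (LOCC d)) :=
  (isCompact_SEP d).of_isClosed_subset isClosed_closure (closure_LOCC_subset_SEP d)

theorem isDensity_of_mem_SEP {d : ℕ} {Λ : BiMat d d → BiMat d d} (hΛ : Λ ∈ SEP d) (ρ : State d) :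
    IsDensity (Λ ρ.1) := by
  obtain ⟨k, A, B, h1, h⟩ := hΛ
  rw [h]
  refine ⟨Matrix.posSemidef_sum _ fun i _ => ρ.2.1.mul_mul_conjTranspose_same _, ?_⟩
  rw [Matrix.trace_sum, trace_sum_kraus _ h1, ρ.2.2]

/-! ### The entanglement measures `E_σ` -/

section Distance

variable {d : ℕ} {D : State d → State d → ℝ}

/-- The composition of two LOCC operations. -/
def LOCC.comp (Λ Λ' : LOCC d) : LOCC d := ⟨fun X => Λ.1 (Λ'.1 X), IsLOCC.comp Λ.2 Λ'.2⟩

/-- The identity as an LOCC operation. -/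
def LOCC.id (d : ℕ) : LOCC d := ⟨fun X => X, IsLOCC.finish⟩

instance : Nonempty (LOCC d) := ⟨LOCC.id d⟩

theorem State.dim_pos (ρ : State d) : 0 < d := by
  rcases Nat.eq_zero_or_pos d with rfl | h
  · have := ρ.2.2
    simp [Matrix.trace] at this
  · exact h

theorem exists_isSeparable (hd : 0 < d) : ∃ τ : State d, IsSeparable τ := by
  let i : Fin d := ⟨0, hd⟩
  have hα : IsDensity (Matrix.vecMulVec (Pi.single i (1 : ℂ)) (star (Pi.single i (1 : ℂ)))) :=
    ⟨Matrix.posSemidef_vecMulVec_self_star _, by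
      rw [Matrix.trace_vecMulVec]; simp⟩
  exact ⟨⟨_, hα.1.kronecker hα.1, by rw [Matrix.trace_kronecker, hα.2, mul_one]⟩, 1, fun _ => 1,
    fun _ => _, fun _ => _, fun _ => zero_le_one, by simp, fun _ => hα, fun _ => hα, by simp⟩

/-- Mapping both arguments to a fixed separable state shows that a contractive distance is
nonnegative. -/
theorem IsContractiveDistance.nonneg (hD : IsContractiveDistance D) (ρ τ : State d) :
    0 ≤ D ρ τ := by
  obtain ⟨s, hs⟩ := exists_isSeparable ρ.dim_pos
  obtain ⟨Λ, hΛ⟩ := exists_LOCC_const hs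
  have := hD.contractive Λ ρ τ
  rwa [hΛ, hΛ, (hD.eq_zero_iff s s).mpr rfl] at this

theorem bddBelow_orbit (hD : IsContractiveDistance D) (σ ρ : State d) :
    BddBelow (Set.range fun Λ : LOCC d => D σ (ρ.map Λ)) :=
  ⟨0, by rintro _ ⟨Λ, rfl⟩; exact hD.nonneg _ _⟩

theorem bddBelow_distEnt (hD : IsContractiveDistance D) (σ : State d) :
    BddBelow (Set.range fun τ : {τ : State d // IsSeparable τ} => D σ τ.1) :=
  ⟨0, by rintro _ ⟨Λ, rfl⟩; exact hD.nonneg _ _⟩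

theorem asymEnt_nonneg (hD : IsContractiveDistance D) (σ ρ : State d) : 0 ≤ asymEnt D σ ρ := by
  obtain ⟨s, hs⟩ := exists_isSeparable ρ.dim_pos
  have : Nonempty {τ : State d // IsSeparable τ} := ⟨⟨s, hs⟩⟩
  refine sub_nonneg.mpr (le_ciInf fun τ => ?_)
  obtain ⟨Λ, hΛ⟩ := exists_LOCC_const τ.2
  exact (ciInf_le (bddBelow_orbit hD σ ρ) Λ).trans_eq (by rw [hΛ])

theorem asymEnt_of_isSeparable (hD : IsContractiveDistance D) (σ : State d) {ρ : State d}
    (hρ : IsSeparable ρ) : asymEnt D σ ρ = 0 :=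
  le_antisymm (sub_nonpos.mpr <| le_ciInf fun Λ =>
    ciInf_le (bddBelow_distEnt hD σ) ⟨ρ.map Λ, hρ.map Λ⟩) (asymEnt_nonneg hD σ ρ)

theorem asymEnt_map_le (hD : IsContractiveDistance D) (σ ρ : State d) (Λ : LOCC d) :
    asymEnt D σ (ρ.map Λ) ≤ asymEnt D σ ρ :=
  sub_le_sub_left (le_ciInf fun Λ' => ciInf_le (bddBelow_orbit hD σ ρ) (LOCC.comp Λ' Λ)) _

theorem asymEnt_self (hD : IsContractiveDistance D) (σ : State d) :
    asymEnt D σ σ = distEnt D σ := by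
  have h : ⨅ Λ : LOCC d, D σ (σ.map Λ) = 0 :=
    le_antisymm ((ciInf_le (bddBelow_orbit hD σ σ) (LOCC.id d)).trans_eq
      ((hD.eq_zero_iff _ _).mpr rfl)) (le_ciInf fun _ => hD.nonneg _ _)
  rw [asymEnt, h, sub_zero]

theorem State.swap_val (ρ : State d) : ρ.swap.1 = flip ρ.1 := swapV_conj _

/-- Conjugation with the swap maps the closure of LOCC to itself. -/
theorem flip_mem_closure_LOCC {Λ : BiMat d d → BiMat d d} (hΛ : Λ ∈ closure (LOCC d)) :
    (fun X => flip (Λ (flip X))) ∈ closure (LOCC d) := by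
  have hc : Continuous fun (Λ : BiMat d d → BiMat d d) (X : BiMat d d) => flip (Λ (flip X)) :=
    continuous_pi fun X => (continuous_apply (flip X)).matrix_submatrix _ _
  exact map_mem_closure hc hΛ fun Λ h => IsLOCC.flip h

theorem swappableBy_closure_iff (σ : State d) :
    SwappableBy (closure (LOCC d)) σ ↔ ∃ Λ ∈ closure (LOCC d), Λ σ.swap.1 = σ.1 := by
  rw [SwappableBy, State.swap_val]
  constructor <;> rintro ⟨Λ, hΛ, h⟩ <;> refine ⟨_, flip_mem_closure_LOCC hΛ, ?_⟩
  · simp only [flip_flip, h]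
  · simp only [h]

/-- The infimum over LOCC of `D(σ, Λ(ρ))` is positive exactly when `σ` is not the image of `ρ`
under an operation in the closure of LOCC: by compactness the infimum is attained on the
closure. -/
theorem iInf_pos_iff (hD : IsContractiveDistance D) (σ ρ : State d) :
    0 < ⨅ Λ : LOCC d, D σ (ρ.map Λ) ↔ ¬ ∃ Λ ∈ closure (LOCC d), Λ ρ.1 = σ.1 := by
  have hcont : Continuous fun τ : State d => D σ τ :=
    hD.continuous.comp (Continuous.prodMk continuous_const continuous_id)
  constructor
  · rintro hpos ⟨Λ, hΛ, h⟩
    have hmem : σ ∈ closure (Set.range fun Λ : LOCC d => ρ.map Λ) := by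
      rw [closure_subtype, ← h]
      refine map_mem_closure (f := fun Λ : BiMat d d → BiMat d d => Λ ρ.1)
        (continuous_apply ρ.1) hΛ fun Λ' h' => ?_
      exact ⟨ρ.map ⟨Λ', h'⟩, ⟨_, rfl⟩, rfl⟩
    have hsub : closure (Set.range fun Λ : LOCC d => ρ.map Λ) ⊆
        {τ | (⨅ Λ : LOCC d, D σ (ρ.map Λ)) ≤ D σ τ} := by
      refine closure_minimal ?_ (isClosed_le continuous_const hcont)
      rintro _ ⟨Λ, rfl⟩
      exact ciInf_le (bddBelow_orbit hD σ ρ) Λ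
    have := hsub hmem
    rw [Set.mem_ofPred_eq, (hD.eq_zero_iff σ σ).mpr rfl] at this
    exact absurd hpos this.not_gt
  · intro hno
    let R : Set (BiMat d d) := (fun Λ => Λ ρ.1) '' closure (LOCC d)
    have hR : IsCompact R := (isCompact_closure_LOCC d).image (continuous_apply ρ.1)
    have hval : Subtype.val '' (Subtype.val ⁻¹' R : Set (State d)) = R := by
      refine Set.image_preimage_eq_of_subset ?_
      rintro _ ⟨Λ, hΛ, rfl⟩
      exact ⟨⟨_, isDensity_of_mem_SEP (closure_LOCC_subset_SEP d hΛ) ρ⟩, rfl⟩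
    have hT : IsCompact (Subtype.val ⁻¹' R : Set (State d)) :=
      Topology.IsInducing.subtypeVal.isCompact_iff.mpr
        ((congrArg IsCompact hval).mpr hR)
    have hmem : ∀ Λ : LOCC d, ρ.map Λ ∈ (Subtype.val ⁻¹' R : Set (State d)) := fun Λ =>
      ⟨Λ.1, subset_closure Λ.2, rfl⟩
    obtain ⟨τ, ⟨Λ, hΛ, hτ⟩, hmin⟩ := hT.exists_isMinOn ⟨_, hmem (LOCC.id d)⟩ hcont.continuousOn
    refine lt_of_lt_of_le ?_ (le_ciInf fun Λ => hmin (hmem Λ))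
    refine lt_of_le_of_ne (hD.nonneg _ _) fun h => hno ⟨Λ, hΛ, ?_⟩
    rw [(hD.eq_zero_iff σ τ).mp h.symm]
    exact hτ

theorem asymEnt_swap_lt_iff (hD : IsContractiveDistance D) (σ : State d) :
    asymEnt D σ σ.swap < asymEnt D σ σ ↔ ¬ SwappableBy (closure (LOCC d)) σ := by
  rw [asymEnt_self hD, asymEnt, sub_lt_self_iff, iInf_pos_iff hD, swappableBy_closure_iff]

end Distance


/-! ### The convex roof of `G` under product Kraus operators -/

/-- The coefficient matrix of a bipartite vector. -/
def toMat {d : ℕ} (ψ : Fin d × Fin d → ℂ) : Matrix (Fin d) (Fin d) ℂ :=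
  Matrix.of fun i k => ψ (i, k)

theorem gPure_eq {d : ℕ} (ψ : Fin d × Fin d → ℂ) :
    gPure ψ = d * (‖(toMat ψ).det‖ ^ 2) ^ (1 / d : ℝ) := by
  have h : reducedA (proj ψ) = toMat ψ * (toMat ψ).conjTranspose := by
    ext i j
    simp [reducedA, proj, toMat, Matrix.mul_apply, Matrix.vecMulVec_apply]
  rw [gPure, h, Matrix.det_mul, Matrix.det_conjTranspose, Complex.star_def, Complex.mul_conj',
    ← Complex.ofReal_pow, Complex.ofReal_re]

theorem gPure_nonneg {d : ℕ} (ψ : Fin d × Fin d → ℂ) : 0 ≤ gPure ψ := by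
  rw [gPure_eq]; positivity

theorem gPure_swap {d : ℕ} (ψ : Fin d × Fin d → ℂ) : gPure (ψ ∘ Prod.swap) = gPure ψ := by
  have h : toMat (ψ ∘ Prod.swap) = (toMat ψ).transpose := rfl
  rw [gPure_eq, gPure_eq, h, Matrix.det_transpose]

theorem gPure_kron_mulVec {d : ℕ} (A B : Matrix (Fin d) (Fin d) ℂ) (ψ : Fin d × Fin d → ℂ) :
    gPure ((A ⊗ₖ B).mulVec ψ) =
      (‖A.det‖ ^ 2) ^ (1 / d : ℝ) * (‖B.det‖ ^ 2) ^ (1 / d : ℝ) * gPure ψ := by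
  have h : toMat ((A ⊗ₖ B).mulVec ψ) = A * toMat ψ * B.transpose := by
    ext i j
    simp only [toMat, Matrix.of_apply, Matrix.mulVec, dotProduct, Matrix.kroneckerMap_apply,
      Matrix.mul_apply, Matrix.transpose_apply, Fintype.sum_prod_type, Finset.sum_mul]
    rw [Finset.sum_comm]
    exact Finset.sum_congr rfl fun x _ => Finset.sum_congr rfl fun y _ => by ring
  rw [gPure_eq, gPure_eq, h, Matrix.det_mul, Matrix.det_mul, Matrix.det_transpose, norm_mul,
    norm_mul, mul_pow, mul_pow, Real.mul_rpow (by positivity) (by positivity),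
    Real.mul_rpow (by positivity) (by positivity)]
  ring

theorem conj_proj {d : ℕ} (K : BiMat d d) (ψ : Fin d × Fin d → ℂ) :
    K * proj ψ * K.conjTranspose = proj (K.mulVec ψ) := by
  rw [proj, proj, Matrix.mul_vecMulVec, Matrix.vecMulVec_mul, Matrix.star_mulVec]

theorem flip_proj {d : ℕ} (ψ : Fin d × Fin d → ℂ) : flip (proj ψ) = proj (ψ ∘ Prod.swap) := rfl

theorem gConc_le {d : ℕ} {ρ : State d} {ι : Type} [Fintype ι] (ψ : ι → Fin d × Fin d → ℂ)
    (h : ρ.1 = ∑ i, proj (ψ i)) : gConc ρ ≤ ∑ i, gPure (ψ i) := by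
  let e := Fintype.equivFin ι
  refine csInf_le ⟨0, ?_⟩ ⟨Fintype.card ι, fun i => ψ (e.symm i), ?_, ?_⟩
  · rintro _ ⟨k, ψ, -, rfl⟩
    exact Finset.sum_nonneg fun i _ => gPure_nonneg _
  · rw [h, e.symm.sum_comp fun i => proj (ψ i)]
  · rw [e.symm.sum_comp fun i => gPure (ψ i)]

/-- If a product Kraus map sends `σ` to the swapped state, pushing the decompositions of `σ`
through the map bounds `G(σ)` by a multiple of itself. -/
theorem one_le_sum_det {d : ℕ} {σ : State d} (hG : 0 < gConc σ) {k : ℕ}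
    {A B : Fin k → Matrix (Fin d) (Fin d) ℂ}
    (hs : ∑ i, (A i ⊗ₖ B i) * σ.1 * (A i ⊗ₖ B i).conjTranspose = σ.swap.1) :
    1 ≤ ∑ i, (‖(A i).det‖ ^ 2) ^ (1 / d : ℝ) * (‖(B i).det‖ ^ 2) ^ (1 / d : ℝ) := by
  set c := ∑ i, (‖(A i).det‖ ^ 2) ^ (1 / d : ℝ) * (‖(B i).det‖ ^ 2) ^ (1 / d : ℝ) with hc
  have hc0 : 0 ≤ c := Finset.sum_nonneg fun i _ => by positivity
  have key : ∀ g ∈ {g | ∃ (k : ℕ) (ψ : Fin k → Fin d × Fin d → ℂ),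
      σ.1 = ∑ i, proj (ψ i) ∧ g = ∑ i, gPure (ψ i)}, gConc σ ≤ c * g := by
    rintro _ ⟨l, ψ, hψ, rfl⟩
    have h : σ.1 = ∑ s : Fin k × Fin l,
        proj ((A s.1 ⊗ₖ B s.1).mulVec (ψ s.2) ∘ Prod.swap) := by
      rw [State.swap_val] at hs
      rw [← flip_flip σ.1, ← hs, hψ, Fintype.sum_prod_type]
      simp only [Matrix.mul_sum, Matrix.sum_mul, conj_proj, flip_sum, flip_proj]
    refine (gConc_le _ h).trans_eq ?_
    simp only [gPure_swap, gPure_kron_mulVec, Fintype.sum_prod_type]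
    rw [hc, Finset.sum_mul_sum]
  -- the infimum over the empty set is zero, so `σ` has a decomposition
  have hne : {g | ∃ (k : ℕ) (ψ : Fin k → Fin d × Fin d → ℂ),
      σ.1 = ∑ i, proj (ψ i) ∧ g = ∑ i, gPure (ψ i)}.Nonempty := by
    by_contra h
    rw [Set.not_nonempty_iff_eq_empty] at h
    rw [gConc, h, Real.sInf_empty] at hG
    exact hG.false
  have hcpos : 0 < c := by
    refine lt_of_le_of_ne hc0 fun h0 => ?_
    obtain ⟨g, hg⟩ := hne
    have := key g hg
    rw [← h0, zero_mul] at this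
    exact absurd hG this.not_gt
  have h : gConc σ / c ≤ gConc σ :=
    le_csInf hne fun g hg => (div_le_iff₀' hcpos).mpr (key g hg)
  rw [div_le_iff₀ hcpos] at h
  exact le_of_mul_le_mul_left (by simpa using h) hG

/-! ### Equality in the inequality of arithmetic and geometric means -/

/-- The arithmetic-geometric mean inequality for the eigenvalues of `Aᴴ A`, with its case of
equality. -/
theorem det_rpow_le_trace {d : ℕ} (hd : 0 < d) (A : Matrix (Fin d) (Fin d) ℂ) :
    (‖A.det‖ ^ 2) ^ (1 / d : ℝ) ≤ (A.conjTranspose * A).trace.re / d ∧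
      ((‖A.det‖ ^ 2) ^ (1 / d : ℝ) = (A.conjTranspose * A).trace.re / d →
        A.conjTranspose * A = (((A.conjTranspose * A).trace.re / d : ℝ) : ℂ) • 1) := by
  have hP := Matrix.posSemidef_conjTranspose_mul_self A
  have hH := hP.isHermitian
  have hdR : (0 : ℝ) < d := by exact_mod_cast hd
  have hdet : ‖A.det‖ ^ 2 = ∏ i, hH.eigenvalues i := by
    have h : (A.conjTranspose * A).det = ((∏ i, hH.eigenvalues i : ℝ) : ℂ) := by
      rw [hH.det_eq_prod_eigenvalues, Complex.ofReal_prod]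
      rfl
    rw [Matrix.det_mul, Matrix.det_conjTranspose, Complex.star_def, Complex.conj_mul'] at h
    exact_mod_cast h
  have htr : (A.conjTranspose * A).trace.re / d = ∑ i, (1 / d : ℝ) * hH.eigenvalues i := by
    rw [hH.trace_eq_sum_eigenvalues, ← Finset.mul_sum]
    simp
    ring
  have hnn : ∀ i ∈ Finset.univ, 0 ≤ hH.eigenvalues i := fun i _ => hP.eigenvalues_nonneg i
  have hw : ∑ _i : Fin d, (1 / d : ℝ) = 1 := by simp [hdR.ne']
  rw [htr, hdet, ← Real.finsetProd_rpow _ _ hnn]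
  refine ⟨Real.geom_mean_le_arith_mean_weighted _ _ _ (fun _ _ => by positivity) hw hnn,
    fun h => ?_⟩
  have hall := (Real.geom_mean_eq_arith_mean_weighted_iff_of_pos' Finset.univ _ _
    (fun _ _ => by positivity) hw hnn).mp h
  have hdiag : Matrix.diagonal (RCLike.ofReal ∘ hH.eigenvalues) =
      ((∑ i, (1 / d : ℝ) * hH.eigenvalues i : ℝ) : ℂ) • (1 : Matrix (Fin d) (Fin d) ℂ) := by
    rw [Matrix.smul_one_eq_diagonal]
    congr 1
    funext j
    simp only [Function.comp_apply]
    exact congrArg _ (hall j (Finset.mem_univ j))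
  conv_lhs => rw [hH.spectral_theorem, hdiag, map_smul, map_one]

/-- A separable operation swapping a state with `G > 0` is a mixture of local unitaries. -/
theorem kraus_unitary_of_swap {d : ℕ} {σ : State d} (hG : 0 < gConc σ) {k : ℕ}
    {A B : Fin k → Matrix (Fin d) (Fin d) ℂ}
    (hK : ∑ i, (A i ⊗ₖ B i).conjTranspose * (A i ⊗ₖ B i) = 1)
    (hs : ∑ i, (A i ⊗ₖ B i) * σ.1 * (A i ⊗ₖ B i).conjTranspose = σ.swap.1) (i : Fin k) :
    A i ⊗ₖ B i = 0 ∨ ∃ x y : ℝ, 0 < x ∧ 0 < y ∧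
      (A i).conjTranspose * A i = (x : ℂ) • 1 ∧ (B i).conjTranspose * B i = (y : ℂ) • 1 := by
  have hd := σ.dim_pos
  have hdR : (0 : ℝ) < d := by exact_mod_cast hd
  let t : Matrix (Fin d) (Fin d) ℂ → ℝ := fun A => (A.conjTranspose * A).trace.re / d
  have htc : ∀ A : Matrix (Fin d) (Fin d) ℂ, (A.conjTranspose * A).trace = ((t A * d : ℝ) : ℂ) :=
    fun A => by
      have h0 := (Matrix.posSemidef_conjTranspose_mul_self A).trace_nonneg
      rw [Complex.nonneg_iff] at h0
      rw [div_mul_cancel₀ _ hdR.ne']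
      exact Complex.ext rfl (by simp [← h0.2])
  have ht0 : ∀ A, 0 ≤ t A := fun A => (by positivity : (0 : ℝ) ≤ _).trans (det_rpow_le_trace hd A).1
  have hsum : ∑ i, t (A i) * t (B i) = 1 := by
    have h := congrArg Matrix.trace hK
    simp only [Matrix.trace_sum, Matrix.conjTranspose_kronecker, ← Matrix.mul_kronecker_mul,
      Matrix.trace_kronecker, htc, Matrix.trace_one, Fintype.card_prod, Fintype.card_fin] at h
    have h' : ∑ i, t (A i) * d * (t (B i) * d) = (d : ℝ) * d := by exact_mod_cast h
    have h'' : (∑ i, t (A i) * t (B i)) * (d * d) = 1 * (d * d) := by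
      rw [one_mul, Finset.sum_mul]
      refine Eq.trans ?_ h'
      exact Finset.sum_congr rfl fun _ _ => by ring
    exact mul_right_cancel₀ (by positivity) h''
  have hle : ∀ i ∈ Finset.univ,
      (‖(A i).det‖ ^ 2) ^ (1 / d : ℝ) * (‖(B i).det‖ ^ 2) ^ (1 / d : ℝ) ≤ t (A i) * t (B i) :=
    fun i _ => mul_le_mul (det_rpow_le_trace hd _).1 (det_rpow_le_trace hd _).1 (by positivity)
      (ht0 _)
  have heq := (Finset.sum_eq_sum_iff_of_le hle).mp
    (le_antisymm (Finset.sum_le_sum hle) (hsum.le.trans (one_le_sum_det hG hs))) i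
    (Finset.mem_univ i)
  have hzero : ∀ A : Matrix (Fin d) (Fin d) ℂ, t A = 0 → A = 0 := fun A h => by
    rw [← Matrix.trace_conjTranspose_mul_self_eq_zero_iff, htc, h, zero_mul, Complex.ofReal_zero]
  rcases (ht0 (A i)).eq_or_lt with h | hA
  · left; rw [hzero _ h.symm, Matrix.zero_kronecker]
  rcases (ht0 (B i)).eq_or_lt with h | hB
  · left; rw [hzero _ h.symm, Matrix.kronecker_zero]
  right
  have hxA := (det_rpow_le_trace hd (A i)).1
  have hxB := (det_rpow_le_trace hd (B i)).1
  refine ⟨t (A i), t (B i), hA, hB, (det_rpow_le_trace hd _).2 (hxA.antisymm ?_),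
    (det_rpow_le_trace hd _).2 (hxB.antisymm ?_)⟩
  · refine le_of_mul_le_mul_right ?_ hB
    exact heq.symm.le.trans (mul_le_mul_of_nonneg_left hxB (by positivity))
  · refine le_of_mul_le_mul_left ?_ hA
    exact heq.symm.le.trans (mul_le_mul_of_nonneg_right hxA (by positivity))

/-- A mixture of local unitaries is LOCC: the first party draws the index, announces it, and both
apply their unitaries. -/
theorem swappableBy_LOCC_of_SEP {d : ℕ} {σ : State d} (hG : 0 < gConc σ)
    (h : SwappableBy (SEP d) σ) : SwappableBy (LOCC d) σ := by
  obtain ⟨Λ, ⟨k, A, B, hK, hΛ⟩, hs⟩ := h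
  refine ⟨Λ, ?_, hs⟩
  have hAW : ∀ i, ∃ A' W : Matrix (Fin d) (Fin d) ℂ, A' ⊗ₖ W = A i ⊗ₖ B i ∧
      W.conjTranspose * W = 1 := fun i => by
    rcases kraus_unitary_of_swap hG hK (by rw [← hΛ, hs]) i with h0 | ⟨x, y, -, hy, -, hB⟩
    · exact ⟨0, 1, by rw [h0, Matrix.zero_kronecker], by simp⟩
    · have hne : ((√y : ℝ) : ℂ) ≠ 0 := by exact_mod_cast (Real.sqrt_pos.mpr hy).ne'
      have hyy : ((√y : ℝ) : ℂ) * ((√y : ℝ) : ℂ) = y := by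
        rw [← Complex.ofReal_mul, Real.mul_self_sqrt hy.le]
      refine ⟨((√y : ℝ) : ℂ) • A i, ((√y : ℝ) : ℂ)⁻¹ • B i, ?_, ?_⟩
      · rw [Matrix.smul_kronecker, Matrix.kronecker_smul, smul_smul, mul_inv_cancel₀ hne, one_smul]
      · rw [Matrix.conjTranspose_smul, Matrix.smul_mul, Matrix.mul_smul, smul_smul, hB, smul_smul,
          star_inv₀, Complex.star_def, Complex.conj_ofReal, ← hyy]
        field_simp
        simp
  choose A' W hA'W hW using hAW
  have hA' : ∑ i, (A' i).conjTranspose * A' i = 1 := by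
    simp only [← hA'W, Matrix.conjTranspose_kronecker, ← Matrix.mul_kronecker_mul, hW] at hK
    let u : Fin d := ⟨0, σ.dim_pos⟩
    ext x y
    have := congrFun (congrFun hK (x, u)) (y, u)
    simpa [Matrix.sum_apply, Matrix.one_apply, Matrix.kroneckerMap_apply] using this
  refine (IsLOCC.alice A' hA' _ fun i => isLOCC_bob (fun _ : Unit => W i) (by simp [hW]) _
    fun _ => IsLOCC.finish).congr fun X => ?_
  rw [hΛ]
  simp only [kron_conj_mul, Matrix.one_mul, Matrix.mul_one, hA'W, Finset.univ_unique,
    Finset.sum_singleton]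


/-! ### Two-qubit states that cannot be swapped -/

/-- Two decompositions into pure states have vectors orthogonal to the same vectors, those in the
kernel of the operator. -/
theorem dotProduct_eq_zero_of_sum_proj_eq {d : ℕ} {ι κ : Type} [Fintype ι] [Fintype κ]
    {χ : ι → Fin d × Fin d → ℂ} {θ : κ → Fin d × Fin d → ℂ}
    (h : ∑ i, proj (χ i) = ∑ j, proj (θ j)) {v : Fin d × Fin d → ℂ}
    (hv : ∀ j, star v ⬝ᵥ θ j = 0) (i : ι) : star v ⬝ᵥ χ i = 0 := by
  have hq : ∀ ψ : Fin d × Fin d → ℂ,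
      star v ⬝ᵥ (proj ψ).mulVec v = ((‖star v ⬝ᵥ ψ‖ ^ 2 : ℝ) : ℂ) := fun ψ => by
    have hc : star ψ ⬝ᵥ v = star (star v ⬝ᵥ ψ) := by
      rw [Matrix.star_dotProduct]
    rw [proj, Matrix.vecMulVec_mulVec, hc, Complex.ofReal_pow, ← Complex.mul_conj',
      Complex.star_def]
    simp [mul_comm]
  have h' := congrArg (fun M => star v ⬝ᵥ M.mulVec v) h
  simp only [Matrix.sum_mulVec, dotProduct_sum, hq, hv] at h'
  have h0 : ∑ i, ‖star v ⬝ᵥ χ i‖ ^ 2 = 0 := by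
    have : ((∑ i, ‖star v ⬝ᵥ χ i‖ ^ 2 : ℝ) : ℂ) = 0 := by
      rw [Complex.ofReal_sum, h']; simp
    exact_mod_cast this
  have := (Finset.sum_eq_zero_iff_of_nonneg fun _ _ => by positivity).mp h0 i (Finset.mem_univ i)
  simpa using this

theorem proj_smul {d : ℕ} (t : ℝ) (ht : 0 ≤ t) (ψ : Fin d × Fin d → ℂ) :
    proj (((√t : ℝ) : ℂ) • ψ) = (t : ℂ) • proj ψ := by
  have : ((√t : ℝ) : ℂ) * ((√t : ℝ) : ℂ) = t := by
    rw [← Complex.ofReal_mul, Real.mul_self_sqrt ht]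
  ext i j
  simp only [proj, Matrix.vecMulVec_apply, Pi.smul_apply, Pi.star_apply, smul_eq_mul, star_mul',
    Complex.star_def, Complex.conj_ofReal, Matrix.smul_apply]
  rw [← this]; ring

/-- The vector `a|00⟩ + b|11⟩`. -/
def schmidt (a b : ℝ) : Fin 2 × Fin 2 → ℂ := (a : ℂ) • ket 0 0 + (b : ℂ) • ket 1 1

theorem sum_fin_two_sq {α : Type} [AddCommMonoid α] (f : Fin 2 × Fin 2 → α) :
    ∑ x, f x = f (0, 0) + f (0, 1) + (f (1, 0) + f (1, 1)) := by
  simp [Fintype.sum_prod_type]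

theorem schmidt_apply (a b : ℝ) : schmidt a b (0, 0) = a ∧ schmidt a b (0, 1) = 0 ∧
    schmidt a b (1, 0) = 0 ∧ schmidt a b (1, 1) = b := by
  simp [schmidt, ket]

theorem trace_proj {d : ℕ} (ψ : Fin d × Fin d → ℂ) : (proj ψ).trace = ψ ⬝ᵥ star ψ :=
  Matrix.trace_vecMulVec _ _

/-- The state `p |01⟩⟨01| + (1 - p) |φ⟩⟨φ|` with `φ = a|00⟩ + b|11⟩`. -/
noncomputable def schmidtMix (p a b : ℝ) (hp0 : 0 ≤ p) (hp1 : p ≤ 1) (hab : a ^ 2 + b ^ 2 = 1) :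
    State 2 :=
  ⟨(p : ℂ) • proj (ket 0 1) + ((1 - p : ℝ) : ℂ) • proj (schmidt a b),
    ((Matrix.posSemidef_vecMulVec_self_star _).smul (Complex.zero_le_real.mpr hp0)).add
      ((Matrix.posSemidef_vecMulVec_self_star _).smul
        (Complex.zero_le_real.mpr (sub_nonneg.mpr hp1))), by
    have hab' : (a : ℂ) * a + b * b = 1 := by
      rw [← sq, ← sq]; exact_mod_cast hab
    obtain ⟨h1, h2, h3, h4⟩ := schmidt_apply a b
    rw [Matrix.trace_add, Matrix.trace_smul, Matrix.trace_smul, trace_proj, trace_proj]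
    simp only [dotProduct, sum_fin_two_sq, Pi.star_apply, h1, h2, h3, h4]
    simp [ket, hab']⟩

section Example

variable {p a b : ℝ} (hp0 : 0 < p) (hp1 : p < 1)
  (hab : a ^ 2 + b ^ 2 = 1)

theorem schmidtMix_eq : (schmidtMix p a b hp0.le hp1.le hab).1 =
    ∑ s : Bool, proj (bif s then ((√p : ℝ) : ℂ) • ket 0 1
      else ((√(1 - p) : ℝ) : ℂ) • schmidt a b) := by
  rw [Fintype.sum_bool, cond_true, cond_false, proj_smul _ hp0.le,
    proj_smul _ (sub_nonneg.mpr hp1.le)]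
  rfl

/-- Every vector of a decomposition is `x |01⟩ + y φ` and has `G = 2 a b |y|²`, and the weights
`|y|²` add up to `1 - p`. -/
theorem gConc_schmidtMix_pos (ha : 0 < a) (hb : 0 < b) :
    0 < gConc (schmidtMix p a b hp0.le hp1.le hab) := by
  have hpos : 0 < 2 * (a * b * (1 - p)) := by
    have := sub_pos.mpr hp1
    positivity
  refine hpos.trans_le (le_csInf ?_ ?_)
  · refine ⟨_, 2, ![((√p : ℝ) : ℂ) • ket 0 1, ((√(1 - p) : ℝ) : ℂ) • schmidt a b], ?_, rfl⟩
    rw [schmidtMix_eq hp0 hp1, Fin.sum_univ_two, Fintype.sum_bool]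
    rfl
  rintro _ ⟨k, ψ, hψ, rfl⟩
  have hdec := hψ.symm.trans (schmidtMix_eq hp0 hp1 hab)
  obtain ⟨h1, h2, h3, h4⟩ := schmidt_apply a b
  -- the range of the state is spanned by `|01⟩` and `φ`
  have h10 : ∀ i, ψ i (1, 0) = 0 := fun i => by
    have := dotProduct_eq_zero_of_sum_proj_eq hdec (v := ket 1 0) (by
      rintro (_ | _) <;>
        simp [dotProduct, h3, ket, Pi.single_apply]) i
    simpa [dotProduct, sum_fin_two_sq, ket, Pi.single_apply] using this
  have h01 : ∀ i, (b : ℂ) * ψ i (0, 0) = a * ψ i (1, 1) := fun i => by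
    have := dotProduct_eq_zero_of_sum_proj_eq hdec
      (v := (b : ℂ) • ket 0 0 - (a : ℂ) • ket 1 1) (by
      rintro (_ | _) <;>
        simp [dotProduct, sum_fin_two_sq, h1, h2, h3, h4, ket, Pi.single_apply]
      ring) i
    simp [dotProduct, sum_fin_two_sq, ket, Pi.single_apply] at this
    linear_combination this
  have hsum : ∑ i, ‖ψ i (0, 0)‖ ^ 2 = (1 - p) * a ^ 2 := by
    have h := congrFun (congrFun hψ (0, 0)) (0, 0)
    simp only [schmidtMix, Matrix.add_apply, Matrix.smul_apply, Matrix.sum_apply, proj,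
      Matrix.vecMulVec_apply, Pi.star_apply, h1, Complex.star_def, Complex.mul_conj'] at h
    simp [ket] at h
    have h' : (1 - p) * a ^ 2 = ∑ i, ‖ψ i (0, 0)‖ ^ 2 := by
      rw [← sq_abs a]; exact_mod_cast h
    exact h'.symm
  have hg : ∀ i, gPure (ψ i) = 2 * (b / a) * ‖ψ i (0, 0)‖ ^ 2 := fun i => by
    have hn : b * ‖ψ i (0, 0)‖ = a * ‖ψ i (1, 1)‖ := by
      have := congrArg norm (h01 i)
      simpa [abs_of_pos ha, abs_of_pos hb] using this
    have hsq : ∀ x : ℝ, 0 ≤ x → (x ^ 2) ^ (1 / 2 : ℝ) = x := fun x hx => by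
      rw [← Real.sqrt_eq_rpow, Real.sqrt_sq hx]
    rw [gPure_eq, Nat.cast_ofNat, hsq _ (norm_nonneg _), Matrix.det_fin_two]
    simp only [toMat, Matrix.of_apply, h10, mul_zero, sub_zero, norm_mul]
    have hn' : ‖ψ i (1, 1)‖ = b / a * ‖ψ i (0, 0)‖ := by
      field_simp; linarith
    rw [hn']; ring
  simp only [hg]
  rw [← Finset.mul_sum, hsum]
  refine le_of_eq ?_
  field_simp

/-- A `2 × 2` multiple of a unitary has diagonal entries of the same modulus, and anti-diagonal
entries of the same modulus, and does not vanish. -/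
theorem norm_entries_of_unitary {A : Matrix (Fin 2) (Fin 2) ℂ} {x : ℝ} (hx : 0 < x)
    (hA : A.conjTranspose * A = (x : ℂ) • 1) :
    ‖A 0 0‖ = ‖A 1 1‖ ∧ ‖A 0 1‖ = ‖A 1 0‖ ∧ ‖A 0 0‖ ^ 2 + ‖A 1 0‖ ^ 2 = x := by
  have hA' : A * A.conjTranspose = (x : ℂ) • 1 := by
    have hx' : (x : ℂ) ≠ 0 := by exact_mod_cast hx.ne'
    have : ((x : ℂ)⁻¹ • A.conjTranspose) * A = 1 := by
      rw [Matrix.smul_mul, hA, smul_smul, inv_mul_cancel₀ hx', one_smul]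
    have := mul_eq_one_comm.mp this
    rw [Matrix.mul_smul] at this
    rw [← this, smul_smul, mul_inv_cancel₀ hx', one_smul]
  have e := fun i => congrFun (congrFun hA i) i
  have e' := fun i => congrFun (congrFun hA' i) i
  simp only [Matrix.mul_apply, Fin.sum_univ_two, Matrix.conjTranspose_apply, Complex.star_def,
    Complex.conj_mul', Complex.mul_conj', Matrix.smul_apply, Matrix.one_apply_eq, smul_eq_mul,
    mul_one] at e e'
  have e0 : ‖A 0 0‖ ^ 2 + ‖A 1 0‖ ^ 2 = x := by exact_mod_cast e 0
  have e0' : ‖A 0 0‖ ^ 2 + ‖A 0 1‖ ^ 2 = x := by exact_mod_cast e' 0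
  have e1 : ‖A 0 1‖ ^ 2 + ‖A 1 1‖ ^ 2 = x := by exact_mod_cast e 1
  refine ⟨?_, ?_, e0⟩
  · exact (sq_eq_sq₀ (norm_nonneg _) (norm_nonneg _)).mp (by linarith)
  · exact (sq_eq_sq₀ (norm_nonneg _) (norm_nonneg _)).mp (by linarith)

/-- A local unitary that maps the range of the state to the range of the swapped state maps `|01⟩`
to `|10⟩` and therefore exchanges `|00⟩` and `|11⟩`, up to phases; this forces `a = b`. -/
theorem not_swappableBy_SEP_schmidtMix (ha : 0 < a) (hb : 0 < b) (hne : a ≠ b) :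
    ¬ SwappableBy (SEP 2) (schmidtMix p a b hp0.le hp1.le hab) := by
  rintro ⟨Λ, ⟨k, A, B, hK, hΛ⟩, hs⟩
  rw [hΛ] at hs
  obtain ⟨i, hi⟩ : ∃ i, A i ⊗ₖ B i ≠ 0 := by
    by_contra! h
    simp [h] at hK
  obtain h0 | ⟨x, y, hx, hy, hA, hB⟩ :=
    kraus_unitary_of_swap (gConc_schmidtMix_pos hp0 hp1 hab ha hb) hK hs i
  · exact hi h0
  obtain ⟨h1, h2, h3, h4⟩ := schmidt_apply a b
  rw [State.swap_val, schmidtMix_eq hp0 hp1] at hs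
  simp only [Matrix.mul_sum, Matrix.sum_mul, conj_proj, flip_sum, flip_proj] at hs
  rw [← Fintype.sum_prod_type'
    (f := fun i s => proj ((A i ⊗ₖ B i).mulVec (bif s then ((√p : ℝ) : ℂ) • ket 0 1
      else ((√(1 - p) : ℝ) : ℂ) • schmidt a b)))] at hs
  have hsp : ((√p : ℝ) : ℂ) ≠ 0 := by exact_mod_cast (Real.sqrt_pos.mpr hp0).ne'
  have hsq : ((√(1 - p) : ℝ) : ℂ) ≠ 0 := by
    exact_mod_cast (Real.sqrt_pos.mpr (sub_pos.mpr hp1)).ne'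
  -- `A ⊗ B` maps the range of the state into that of the swapped state, which is orthogonal to
  -- `|01⟩` and to `b|00⟩ - a|11⟩`
  have k1 := fun s => dotProduct_eq_zero_of_sum_proj_eq hs (v := ket 0 1) (by
      rintro (_ | _) <;>
        simp [dotProduct, sum_fin_two_sq, h3, ket, Pi.single_apply]) (i, s)
  have k2 := fun s => dotProduct_eq_zero_of_sum_proj_eq hs
      (v := (b : ℂ) • ket 0 0 - (a : ℂ) • ket 1 1) (by
      rintro (_ | _) <;>
        simp [dotProduct, sum_fin_two_sq, h1, h2, h3, h4, ket, Pi.single_apply]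
      ring) (i, s)
  have k1t := k1 true
  have k2t := k2 true
  have k2f := k2 false
  simp [dotProduct, Matrix.mulVec, sum_fin_two_sq, h1, h2, h3, h4, ket,
    Pi.single_apply, hsp] at k1t k2t k2f
  obtain ⟨hA1, hA2, hA3⟩ := norm_entries_of_unitary hx hA
  obtain ⟨hB1, hB2, hB3⟩ := norm_entries_of_unitary hy hB
  have e2 : (b : ℂ) * (A i 0 0 * B i 0 1) = a * (A i 1 0 * B i 1 1) :=
    mul_right_cancel₀ hsp (by linear_combination k2t)
  have e3 : (b : ℂ) * (a * (A i 0 0 * B i 0 0) + b * (A i 0 1 * B i 0 1)) =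
      a * (a * (A i 1 0 * B i 1 0) + b * (A i 1 1 * B i 1 1)) :=
    mul_right_cancel₀ hsq (by linear_combination k2f)
  have hne' : (a : ℂ) ≠ 0 := by exact_mod_cast ha.ne'
  have hbe' : (b : ℂ) ≠ 0 := by exact_mod_cast hb.ne'
  -- `A|0⟩` and `B|1⟩` are multiples of `|1⟩` and `|0⟩`, as the only product vector in the range of
  -- the swapped state is `|10⟩`
  have hA00 : A i 0 0 = 0 := by
    by_contra h
    have hB11 := k1t.resolve_left h
    have hB00 : ‖B i 0 0‖ = 0 := by rw [hB1, hB11, norm_zero]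
    have hB01 : B i 0 1 = 0 := by simpa [h, hbe', hB11] using e2
    rw [← hB2, hB00, hB01, norm_zero] at hB3
    simp [hy.ne] at hB3
  have hA11 : A i 1 1 = 0 := by
    rw [← norm_eq_zero, ← hA1, hA00, norm_zero]
  have hA10 : ‖A i 1 0‖ ≠ 0 := fun h => by
    rw [hA00, h, norm_zero] at hA3
    simp [hx.ne] at hA3
  have hB11 : B i 1 1 = 0 := by
    simpa [hA00, hne', norm_ne_zero_iff.mp hA10] using e2.symm
  have hB00 : ‖B i 0 0‖ = 0 := by rw [hB1, hB11, norm_zero]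
  have hB10 : ‖B i 1 0‖ ≠ 0 := fun h => by
    rw [hB00, h] at hB3
    simp [hy.ne] at hB3
  -- the image of `φ` has coefficients of moduli proportional to `b` and `a`
  have e4 : b * (b * (‖A i 1 0‖ * ‖B i 1 0‖)) = a * (a * (‖A i 1 0‖ * ‖B i 1 0‖)) := by
    have := congrArg norm e3
    simpa [hA00, hA11, hA2, hB2, abs_of_pos ha, abs_of_pos hb] using this
  have e5 : a ^ 2 = b ^ 2 := by
    refine mul_right_cancel₀ (mul_ne_zero hA10 hB10) ?_
    linear_combination -e4
  exact hne ((sq_eq_sq₀ ha.le hb.le).mp e5)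

end Example

end AsymEnt

theorem mainTheorem2 :
    (∀ (d : ℕ) (D : AsymEnt.State d → AsymEnt.State d → ℝ),
      AsymEnt.IsContractiveDistance D → ∀ σ : AsymEnt.State d,
        -- `E_σ` is nonnegative and vanishes on separable states
        (∀ ρ, 0 ≤ AsymEnt.asymEnt D σ ρ) ∧
        (∀ ρ, AsymEnt.IsSeparable ρ → AsymEnt.asymEnt D σ ρ = 0) ∧
        -- `E_σ` does not increase under LOCC
        (∀ (Λ : AsymEnt.LOCC d) (ρ : AsymEnt.State d),
          AsymEnt.asymEnt D σ (ρ.map Λ) ≤ AsymEnt.asymEnt D σ ρ) ∧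
        AsymEnt.asymEnt D σ σ = AsymEnt.distEnt D σ ∧
        -- asymmetry, for states that no operation in the closure of LOCC swaps
        (AsymEnt.asymEnt D σ σ.swap < AsymEnt.asymEnt D σ σ ↔
          ¬ AsymEnt.SwappableBy (closure (AsymEnt.LOCC d)) σ) ∧
        -- in particular for states that no separable operation swaps
        (¬ AsymEnt.SwappableBy (AsymEnt.SEP d) σ →
          AsymEnt.asymEnt D σ σ.swap < AsymEnt.asymEnt D σ σ) ∧
        -- and, when `G(σ) > 0`, for states that no LOCC operation swaps
        (0 < AsymEnt.gConc σ → ¬ AsymEnt.SwappableBy (AsymEnt.LOCC d) σ →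
          AsymEnt.asymEnt D σ σ.swap < AsymEnt.asymEnt D σ σ)) ∧
    -- two-qubit states that cannot be swapped
    (∀ p a b : ℝ, 0 < p → p < 1 → 0 < a → 0 < b → a ≠ b → a ^ 2 + b ^ 2 = 1 →
      ∃ σ : AsymEnt.State 2,
        σ.1 = (p : ℂ) • AsymEnt.proj (AsymEnt.ket 0 1) +
          ((1 - p : ℝ) : ℂ) • AsymEnt.proj
            ((a : ℂ) • AsymEnt.ket 0 0 + (b : ℂ) • AsymEnt.ket 1 1) ∧
        0 < AsymEnt.gConc σ ∧
        ¬ AsymEnt.SwappableBy (AsymEnt.LOCC 2) σ ∧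
        ¬ AsymEnt.SwappableBy (AsymEnt.SEP 2) σ ∧
        ∀ D : AsymEnt.State 2 → AsymEnt.State 2 → ℝ, AsymEnt.IsContractiveDistance D →
          AsymEnt.asymEnt D σ σ.swap < AsymEnt.asymEnt D σ σ) := by
  refine ⟨fun d D hD σ => ⟨AsymEnt.asymEnt_nonneg hD σ,
    fun ρ => AsymEnt.asymEnt_of_isSeparable hD σ, fun Λ ρ => AsymEnt.asymEnt_map_le hD σ ρ Λ,
    AsymEnt.asymEnt_self hD σ, AsymEnt.asymEnt_swap_lt_iff hD σ, ?_, ?_⟩, ?_⟩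
  · exact fun h => (AsymEnt.asymEnt_swap_lt_iff hD σ).mpr fun ⟨Λ, hΛ, hs⟩ =>
      h ⟨Λ, AsymEnt.closure_LOCC_subset_SEP d hΛ, hs⟩
  · exact fun hG h => (AsymEnt.asymEnt_swap_lt_iff hD σ).mpr fun ⟨Λ, hΛ, hs⟩ =>
      h (AsymEnt.swappableBy_LOCC_of_SEP hG ⟨Λ, AsymEnt.closure_LOCC_subset_SEP d hΛ, hs⟩)
  · intro p a b hp0 hp1 ha hb hne hab
    have hS := AsymEnt.not_swappableBy_SEP_schmidtMix hp0 hp1 hab ha hb hne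
    exact ⟨AsymEnt.schmidtMix p a b hp0.le hp1.le hab, rfl,
      AsymEnt.gConc_schmidtMix_pos hp0 hp1 hab ha hb,
      fun ⟨Λ, hΛ, hs⟩ => hS ⟨Λ, AsymEnt.LOCC_subset_SEP 2 hΛ, hs⟩, hS,
      fun D hD => (AsymEnt.asymEnt_swap_lt_iff hD _).mpr fun ⟨Λ, hΛ, hs⟩ =>
        hS ⟨Λ, AsymEnt.closure_LOCC_subset_SEP 2 hΛ, hs⟩⟩
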